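/- Let $p$ be a prime and $\zeta_p\in\mathbb C$ a primitive $p$-th root of unity. A sequence $(a_i)_{i\ge 0}$ of complex numbers with $a_{i+n}=a_i$ for all $i$ is a $p$-ary nearly perfect sequence (NPS) of period $n$ and type $\gamma$ if every $a_i$ is a power of $\zeta_p$ and $\sum_{i=0}^{n-1}a_i\overline{a_{i+t}}=\gamma$ for all $1\le t\le n-1$. A prime $q$ is self-conjugate modulo a positive integer $m$ if, writing $m=q^sw$ with $\gcd(q,w)=1$, there is an integer $j$ with $q^j\equiv-1\pmod w$. For integers $m$ and $r\ge 0$, write $q^r\,\|\,m$ if $q^r\mid m$ and $q^{r+1}\nmid m$. Theorem. Let $p$ be a prime, $n$ a positive integer and $\gamma$ an integer with $|\gamma|<n$ and $p\mid n-\gamma$. Suppose that a $p$-ary NPS of period $n$ and type $\gamma$ exists. Then the following hold. (i) Let $\gamma=0$, let $q\ne p$ be a prime divisor of $n$ with $q^r\,\|\,n$, and let $u\ge1$ be a divisor of $n$ such that $q$ is self-conjugate modulo $up$. Then $r$ is even and $q^{r/2}\le \frac nu$. (ii) Let $\gamma\ne0$, let $q\neq p$ be a prime divisor of $n-\gamma$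 with $q^r\,\|\,n-\gamma$, and let $u>1$ be a divisor of $n$ such that $q$ is self-conjugate modulo $up$. If $q\nmid u$, then $r$ is even and $q^{r/2}\le\frac nu$. If $q\mid u$, then $q^{\lfloor r/2\rfloor}\le \frac{2n}u$. (iii) Let $\gamma\neq0$, let $p^r\,\|\,n-\gamma$, and let $u>1$ be a divisor of $n$ such that $p\nmid u$ and $p$ is self-conjugate modulo $u$. If $r$ is even, then $p^{r/2}\le\frac{2n}u$. If $r$ is odd, then $p^{(r+1)/2}\le\frac{4n}u$. (iv) Let $\gamma\neq0$, let $q\ne p$ be a prime divisor of $(\gamma+1)n-\gamma$ with $q^r\,\|\,(\gamma+1)n-\gamma$, and let $u\ge1$ be a divisor of $n$ such that $q$ is self-conjugate modulo $up$. If $q\nmid u$, then $r$ is even. -/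

import Mathlib

open scoped ComplexConjugate

/-- The periodic autocorrelation `C_a(t) = ∑_{i=0}^{n-1} a_i * conj (a_{i+t})` of a sequence `a`
(regarded as a sequence of period `n`). -/
noncomputable def autocorrelation (n : ℕ) (a : ℕ → ℂ) (t : ℕ) : ℂ :=
  ∑ i ∈ Finset.range n, a i * conj (a (i + t))

/-- A `p`-ary sequence of period `n`: all its entries are powers of a primitive `p`-th root of
unity. -/
def IsPArySequence (p n : ℕ) (a : ℕ → ℂ) : Prop :=
  Function.Periodic a n ∧ ∃ ζ : ℂ, IsPrimitiveRoot ζ p ∧ ∀ i, ∃ b : ℤ, a i = ζ ^ b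

/-- A `p`-ary nearly perfect sequence (NPS) of period `n` and type `γ`: all out-of-phase
autocorrelation coefficients are equal to `γ`. -/
def IsPAryNPS (p n : ℕ) (γ : ℤ) (a : ℕ → ℂ) : Prop :=
  IsPArySequence p n a ∧ ∀ t : ℕ, 1 ≤ t → t ≤ n - 1 → autocorrelation n a t = (γ : ℂ)

/-- `q` is self-conjugate modulo `u`: writing `u = q ^ s * w` with `gcd (q, w) = 1`, one has
`q ^ j ≡ -1` modulo `w` for some `j`. (Since `q` has finite order modulo `w`, it makes no
difference whether `j` ranges over natural numbers or over all integers.) -/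
def IsSelfConjugateMod (q u : ℕ) : Prop :=
  ∃ s w : ℕ, u = q ^ s * w ∧ Nat.Coprime q w ∧ ∃ j : ℕ, (q : ℤ) ^ j ≡ -1 [ZMOD (w : ℤ)]

/-- `q ^ r ∥ m`: `q ^ r` divides `m` but `q ^ (r + 1)` does not. -/
def ExactPowDvd (q r : ℕ) (m : ℤ) : Prop :=
  (q : ℤ) ^ r ∣ m ∧ ¬ (q : ℤ) ^ (r + 1) ∣ m

open Polynomial

/-! Writing the sequence as `ζ ^ b i`, its character sums `X = ∑ ζ ^ b i * ω ^ i` have squared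
modulus `n - γ` for `ω ≠ 1` and `(γ + 1) * n - γ` for `ω = 1`. If `q` is self-conjugate, complex
conjugation inverts a power of Frobenius modulo `q` (modulo `ξ - 1` in the ramified case), so
divisibility of `X * conj X` passes to `X` with half the exponent. No ideal factorization is needed
(`dvd_of_dvd_mul_of_frobenius`, `pow_dvd_of_pow_dvd_mul`). In the unramified case the half exponent
is rounded up, which forces `r` to be even.

For the bounds, Fourier inversion turns divisibility of all nontrivial `X` into congruences between
the numbers of `i` in a class modulo `u` with `b i = k`. These counts are at most `n / u`, and since
`X ≠ 0` some compared pair differs, so the modulus is at most `n / u`. For `q = p` the variable `ζ`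
cannot be inverted away. Instead the difference of two classes is a polynomial in `ζ` divisible by
`p ^ a * (ζ - 1) ^ t`. Vanishing to order `t` at `1` modulo `p` forces more than `t` nonzero
coefficients, hence a large ℓ¹-norm, while that norm is at most `2 * (n / u)`. -/

/-! ### Halving divisibility with a Frobenius-like involution -/

/-- Modulo `π`, `c` inverts the `N`-th power map. Hence `x ^ 2 ≡ x * c x * c x ^ (N - 1) ≡ 0`, while
`x ≡ x ^ (N * N)`, so the nilpotent `x` vanishes. Primality of `π` plays no role. -/
theorem dvd_of_dvd_mul_of_frobenius {R : Type*} [CommRing R] (c : R →+* R) {π : R} {N : ℕ}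
    (hN : 2 ≤ N) (hcc : ∀ x, c (c x) = x) (h : ∀ x, π ∣ (c x) ^ N - x) {x : R}
    (hx : π ∣ x * c x) : π ∣ x := by
  have h1 : π ∣ x ^ 2 := by
    have e : x ^ 2 = x * c x * (c x) ^ (N - 1) - x * ((c x) ^ N - x) := by
      have : (c x) ^ N = c x * (c x) ^ (N - 1) := by rw [← pow_succ']; congr 1; omega
      rw [this]; ring
    rw [e]
    exact dvd_sub (hx.mul_right _) ((h x).mul_left _)
  have h2 : π ∣ x ^ N - c x := by simpa [hcc] using h (c x)
  have h3 : π ∣ (x ^ N) ^ N - (c x) ^ N := h2.trans (sub_dvd_pow_sub_pow _ _ _)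
  have h4 : π ∣ (x ^ N) ^ N := by
    rw [← pow_mul]
    exact h1.trans (pow_dvd_pow _ (by nlinarith))
  have e : x = (x ^ N) ^ N - ((x ^ N) ^ N - (c x) ^ N) - ((c x) ^ N - x) := by ring
  rw [e]
  exact dvd_sub (dvd_sub h4 h3) (h x)

/-- Descent: removing one `π` from `x` removes `π * c π`, that is `π ^ 2` up to a unit, from the
product. The final step `n = 1` still yields a factor, so the half is rounded up. -/
theorem pow_dvd_of_pow_dvd_mul {R : Type*} [CommRing R] [IsDomain R] (c : R →+* R) {π : R}
    (hπ : π ≠ 0) (hc : Associated (c π) π) (h : ∀ x, π ∣ x * c x → π ∣ x) :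
    ∀ (n : ℕ) (x : R), π ^ n ∣ x * c x → π ^ ((n + 1) / 2) ∣ x := by
  intro n
  induction n using Nat.strong_induction_on with
  | _ n ih =>
    intro x hx
    rcases n with _ | n
    · simp
    obtain ⟨y, rfl⟩ := h x ((dvd_pow_self π (by omega)).trans hx)
    rcases n with _ | n
    · simp
    have e : (n + 1 + 1 + 1) / 2 = (n + 1) / 2 + 1 := by omega
    rw [e, pow_succ']
    refine mul_dvd_mul_left π (ih n (by omega) y ?_)
    obtain ⟨v, hv⟩ := hc.symm
    rw [map_mul, ← hv] at hx
    have e2 : π * y * (π * v * c y) = π ^ 2 * (v * (y * c y)) := by ring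
    rw [e2, show n + 1 + 1 = 2 + n by ring, pow_add] at hx
    exact (Units.dvd_mul_left).1 ((mul_dvd_mul_iff_left (pow_ne_zero 2 hπ)).1 hx)

/-! ### Conjugation on `ℤ[Ω]` and self-conjugate primes -/

theorem conj_mem_adjoin {Ω : ℂ} (h : conj Ω ∈ Algebra.adjoin ℤ {Ω}) {x : ℂ}
    (hx : x ∈ Algebra.adjoin ℤ {Ω}) : conj x ∈ Algebra.adjoin ℤ {Ω} := by
  induction hx using Algebra.adjoin_induction with
  | mem x hx => rw [Set.mem_singleton_iff] at hx; rwa [hx]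
  | algebraMap r => simp
  | add x y _ _ hx hy => rw [map_add]; exact add_mem hx hy
  | mul x y _ _ hx hy => rw [map_mul]; exact mul_mem hx hy

/-- Complex conjugation on `ℤ[Ω]`. -/
noncomputable def conjAdjoin {Ω : ℂ} (h : conj Ω ∈ Algebra.adjoin ℤ {Ω}) :
    Algebra.adjoin ℤ {Ω} →+* Algebra.adjoin ℤ {Ω} :=
  ((starRingEnd ℂ).comp (Algebra.adjoin ℤ {Ω}).val.toRingHom).codRestrict _
    fun x => conj_mem_adjoin h x.2

@[simp]
theorem coe_conjAdjoin {Ω : ℂ} (h : conj Ω ∈ Algebra.adjoin ℤ {Ω}) (x : Algebra.adjoin ℤ {Ω}) :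
    (conjAdjoin h x : ℂ) = conj (x : ℂ) := rfl

theorem conj_eq_inv_of_pow_eq_one {z : ℂ} {n : ℕ} (hn : n ≠ 0) (h : z ^ n = 1) : conj z = z⁻¹ :=
  (Complex.inv_eq_conj (Complex.norm_eq_one_of_pow_eq_one h hn)).symm

theorem inv_mem_adjoin_of_pow_eq_one {z : ℂ} {n : ℕ} (hn : n ≠ 0) (h : z ^ n = 1) :
    z⁻¹ ∈ Algebra.adjoin ℤ {z} := by
  have : z⁻¹ = z ^ (n - 1) := by
    refine inv_eq_of_mul_eq_one_right ?_
    rw [← pow_succ', Nat.sub_add_cancel (Nat.pos_of_ne_zero hn), h]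
  rw [this]
  exact pow_mem (Algebra.self_mem_adjoin_singleton ℤ z) _

/-- The `q ^ j`-th power map is additive modulo `q` and fixes integers by Fermat, so the congruence
need only be checked on the generator. -/
theorem dvd_conjAdjoin_pow_sub {Ω : ℂ} (h : conj Ω ∈ Algebra.adjoin ℤ {Ω}) {q : ℕ}
    (hq : q.Prime) (j : ℕ) {π : Algebra.adjoin ℤ {Ω}} (hπq : π ∣ (q : Algebra.adjoin ℤ {Ω}))
    (hΩ : π ∣ (conjAdjoin h ⟨Ω, Algebra.self_mem_adjoin_singleton ℤ Ω⟩) ^ q ^ j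
      - ⟨Ω, Algebra.self_mem_adjoin_singleton ℤ Ω⟩) (x : Algebra.adjoin ℤ {Ω}) :
    π ∣ (conjAdjoin h x) ^ q ^ j - x := by
  obtain ⟨x, hx⟩ := x
  induction hx using Algebra.adjoin_induction with
  | mem x hx => rw [Set.mem_singleton_iff] at hx; subst hx; exact hΩ
  | algebraMap m =>
    have e : (⟨algebraMap ℤ ℂ m, Subalgebra.algebraMap_mem _ m⟩ : Algebra.adjoin ℤ {Ω})
      = (m : Algebra.adjoin ℤ {Ω}) := by ext; simp
    rw [e, map_intCast]
    have : (q : ℤ) ∣ m ^ q ^ j - m := by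
      have := Fact.mk hq
      rw [← ZMod.intCast_zmod_eq_zero_iff_dvd]
      push_cast
      rw [ZMod.pow_card_pow, sub_self]
    have h2 := map_dvd (Int.castRingHom (Algebra.adjoin ℤ {Ω})) this
    rw [eq_intCast, eq_intCast] at h2
    push_cast at h2
    exact hπq.trans h2
  | add x y hx' hy' hx hy =>
    have e : (⟨x + y, add_mem hx' hy'⟩ : Algebra.adjoin ℤ {Ω}) = ⟨x, hx'⟩ + ⟨y, hy'⟩ := rfl
    rw [e, map_add]
    obtain ⟨z, hz⟩ := exists_add_pow_prime_pow_eq hq (conjAdjoin h ⟨x, hx'⟩)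
      (conjAdjoin h ⟨y, hy'⟩) j
    have := dvd_add (dvd_add hx hy) (hπq.mul_right
      (conjAdjoin h ⟨x, hx'⟩ * conjAdjoin h ⟨y, hy'⟩ * z))
    rw [hz]
    convert this using 1
    ring
  | mul x y hx' hy' hx hy =>
    have e : (⟨x * y, mul_mem hx' hy'⟩ : Algebra.adjoin ℤ {Ω}) = ⟨x, hx'⟩ * ⟨y, hy'⟩ := rfl
    rw [e, map_mul, mul_pow]
    have := dvd_add (hx.mul_right ((conjAdjoin h ⟨y, hy'⟩) ^ q ^ j)) (hy.mul_left ⟨x, hx'⟩)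
    convert this using 1
    ring

/-- `q` is the cyclotomic value at `1`, that is the product of all `1 - μ`, and these factors are
pairwise associated. -/
theorem IsPrimitiveRoot.associated_natCast_sub_one_pow {R : Type*} [CommRing R] [IsDomain R]
    {q s : ℕ} (hq : q.Prime) {ξ : R} (hξ : IsPrimitiveRoot ξ (q ^ (s + 1))) :
    Associated (q : R) ((ξ - 1) ^ Nat.totient (q ^ (s + 1))) := by
  have := Fact.mk hq
  have h1 : (q : R) = ∏ μ ∈ primitiveRoots (q ^ (s + 1)) R, (1 - μ) := by
    rw [← eval_one_cyclotomic_prime_pow (R := R) (p := q) s,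
      cyclotomic_eq_prod_X_sub_primitiveRoots hξ, eval_prod]
    simp
  rw [h1, ← hξ.card_primitiveRoots, ← Finset.prod_const]
  refine Associated.prod _ _ _ fun μ hμ => ?_
  have hpos : 0 < q ^ (s + 1) := pow_pos hq.pos _
  rw [mem_primitiveRoots hpos] at hμ
  have : NeZero (q ^ (s + 1)) := ⟨hpos.ne'⟩
  obtain ⟨i, -, hi, rfl⟩ := hξ.isPrimitiveRoot_iff.1 hμ
  have := (hξ.associated_sub_one_pow_sub_one_of_coprime hi).symm
  rw [← neg_sub]
  exact this.neg_left

/-- A self-conjugate prime divides a sum of roots of unity whenever it divides the squared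
absolute value, to half the exponent. -/
theorem exists_pow_mul_of_mul_conj {q w j r : ℕ} (hq : q.Prime) (hw : 0 < w)
    (hj : w ∣ q ^ j + 1) (hj0 : j ≠ 0) {Ω : ℂ} (hΩ : IsPrimitiveRoot Ω w) {X : ℂ}
    (hX : X ∈ Algebra.adjoin ℤ {Ω}) {N : ℤ} (hN : X * conj X = N) (hr : (q : ℤ) ^ r ∣ N) :
    ∃ y ∈ Algebra.adjoin ℤ {Ω}, X = (q : ℂ) ^ ((r + 1) / 2) * y := by
  have hc : conj Ω = Ω⁻¹ := conj_eq_inv_of_pow_eq_one hw.ne' hΩ.pow_eq_one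
  have h : conj Ω ∈ Algebra.adjoin ℤ {Ω} :=
    hc ▸ inv_mem_adjoin_of_pow_eq_one hw.ne' hΩ.pow_eq_one
  -- Here `conj Ω ^ q ^ j = Ω` exactly, because `w ∣ q ^ j + 1`.
  have hF := dvd_conjAdjoin_pow_sub h hq j (dvd_refl _) (by
    convert dvd_zero _
    rw [sub_eq_zero]
    ext
    push_cast
    rw [coe_conjAdjoin, hc, inv_pow]
    refine inv_eq_of_mul_eq_one_right ?_
    rw [← pow_succ]
    exact (hΩ.pow_eq_one_iff_dvd _).2 hj)
  have hN2 : 2 ≤ q ^ j := hq.two_le.trans (Nat.le_self_pow hj0 q)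
  have := pow_dvd_of_pow_dvd_mul (conjAdjoin h) (π := (q : Algebra.adjoin ℤ {Ω}))
    (by exact_mod_cast hq.ne_zero) (by rw [map_natCast])
    (fun x hx => dvd_of_dvd_mul_of_frobenius _ hN2 (fun x => by ext; simp) hF hx) r ⟨X, hX⟩ (by
      have e : (⟨X, hX⟩ : Algebra.adjoin ℤ {Ω}) * conjAdjoin h ⟨X, hX⟩ = (N : Algebra.adjoin ℤ {Ω}) := by
        ext; simpa using hN
      rw [e]
      simpa using (Int.castRingHom (Algebra.adjoin ℤ {Ω})).map_dvd hr)
  obtain ⟨y, hy⟩ := this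
  refine ⟨y, y.2, ?_⟩
  simpa using congrArg Subtype.val hy

/-- The ramified analogue of `exists_pow_mul_of_mul_conj`. -/
theorem exists_sub_one_pow_mul_of_mul_conj {q s w j r : ℕ} (hq : q.Prime) (hw : 0 < w)
    (hj : w ∣ q ^ j + 1) (hj0 : j ≠ 0) {Ω : ℂ} (hΩ : IsPrimitiveRoot Ω (q ^ (s + 1) * w)) {ξ : ℂ}
    (hξ : IsPrimitiveRoot ξ (q ^ (s + 1))) (hξΩ : ξ ∈ Algebra.adjoin ℤ {Ω}) {X : ℂ}
    (hX : X ∈ Algebra.adjoin ℤ {Ω}) {N : ℤ} (hN : X * conj X = N) (hr : (q : ℤ) ^ r ∣ N) :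
    ∃ y ∈ Algebra.adjoin ℤ {Ω},
      X = (ξ - 1) ^ ((Nat.totient (q ^ (s + 1)) * r + 1) / 2) * y := by
  have hM : q ^ (s + 1) * w ≠ 0 := (Nat.mul_pos (pow_pos hq.pos _) hw).ne'
  have hqs : q ^ (s + 1) ≠ 0 := (pow_pos hq.pos _).ne'
  have hc : conj Ω = Ω⁻¹ := conj_eq_inv_of_pow_eq_one hM hΩ.pow_eq_one
  have h : conj Ω ∈ Algebra.adjoin ℤ {Ω} :=
    hc ▸ inv_mem_adjoin_of_pow_eq_one hM hΩ.pow_eq_one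
  set R := Algebra.adjoin ℤ {Ω} with hR
  let ξ' : R := ⟨ξ, hξΩ⟩
  have hξ' : IsPrimitiveRoot ξ' (q ^ (s + 1)) := IsPrimitiveRoot.coe_submonoidClass_iff.1 hξ
  have hass := hξ'.associated_natCast_sub_one_pow hq
  have hφ : Nat.totient (q ^ (s + 1)) ≠ 0 :=
    (Nat.totient_pos.2 (Nat.pos_of_ne_zero hqs)).ne'
  have hπq : ξ' - 1 ∣ (q : R) := (dvd_pow_self _ hφ).trans hass.symm.dvd
  let Ω' : R := ⟨Ω, Algebra.self_mem_adjoin_singleton ℤ Ω⟩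
  -- Now `Ω ^ (q ^ j + 1)` is only a power of `ξ`, hence `1` modulo `ξ - 1`.
  have hF := dvd_conjAdjoin_pow_sub h hq j hπq (by
    have h1 : (Ω' ^ (q ^ j + 1)) ^ q ^ (s + 1) = 1 := by
      ext
      push_cast
      rw [← pow_mul, mul_comm, hΩ.pow_eq_one_iff_dvd]
      exact mul_dvd_mul_left _ hj
    have : NeZero (q ^ (s + 1)) := ⟨hqs⟩
    obtain ⟨i, -, hi⟩ := hξ'.eq_pow_of_pow_eq_one h1
    have h2 : ξ' - 1 ∣ 1 - Ω' ^ (q ^ j + 1) := by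
      rw [← hi, ← dvd_neg, neg_sub]
      simpa using sub_dvd_pow_sub_pow ξ' 1 i
    have h3 : (conjAdjoin h Ω') ^ q ^ j - Ω'
        = (conjAdjoin h Ω') ^ q ^ j * (1 - Ω' ^ (q ^ j + 1)) := by
      have : (conjAdjoin h Ω') * Ω' = 1 := by
        ext
        push_cast
        rw [coe_conjAdjoin, hc]
        exact inv_mul_cancel₀ (hΩ.ne_zero hM)
      have h4 : (conjAdjoin h Ω') ^ q ^ j * Ω' ^ q ^ j = 1 := by rw [← mul_pow, this, one_pow]
      rw [mul_sub, mul_one, pow_succ, ← mul_assoc, h4, one_mul]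
    change _ ∣ (conjAdjoin h Ω') ^ q ^ j - Ω'
    rw [h3]
    exact h2.mul_left _)
  have hN2 : 2 ≤ q ^ j := hq.two_le.trans (Nat.le_self_pow hj0 q)
  have hπ0 : ξ' - 1 ≠ 0 := sub_ne_zero.2 (hξ'.ne_one (Nat.one_lt_pow (by omega) hq.one_lt))
  have hcπ : Associated (conjAdjoin h (ξ' - 1)) (ξ' - 1) := by
    have hcξ : conjAdjoin h ξ' * ξ' = 1 := by
      ext
      push_cast
      rw [coe_conjAdjoin, conj_eq_inv_of_pow_eq_one hqs hξ.pow_eq_one]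
      exact inv_mul_cancel₀ (hξ.ne_zero hqs)
    have hu : IsUnit (-conjAdjoin h ξ') := (IsUnit.of_mul_eq_one _ hcξ).neg
    have e : conjAdjoin h (ξ' - 1) = -conjAdjoin h ξ' * (ξ' - 1) := by
      rw [map_sub, map_one]
      linear_combination hcξ
    rw [e]
    exact associated_unit_mul_left _ _ hu
  have := pow_dvd_of_pow_dvd_mul (conjAdjoin h) hπ0 hcπ
    (fun x hx => dvd_of_dvd_mul_of_frobenius _ hN2 (fun x => by ext; simp) hF hx)
    (Nat.totient (q ^ (s + 1)) * r) ⟨X, hX⟩ (by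
      have e : (⟨X, hX⟩ : R) * conjAdjoin h ⟨X, hX⟩ = (N : R) := by
        ext; simpa using hN
      rw [e, pow_mul]
      refine (hass.pow_pow.symm.dvd).trans ?_
      simpa using (Int.castRingHom R).map_dvd hr)
  obtain ⟨y, hy⟩ := this
  refine ⟨y, y.2, ?_⟩
  simpa [ξ'] using congrArg Subtype.val hy

/-! ### Divisibility among algebraic integers -/

/-- `d` divides `x` in the ring of algebraic integers. -/
def IntDvd (d x : ℂ) : Prop := IsIntegral ℤ (x / d)

namespace IntDvd

theorem zero (d : ℂ) : IntDvd d 0 := by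
  rw [IntDvd, zero_div]; exact isIntegral_zero

theorem sub {d x y : ℂ} (hx : IntDvd d x) (hy : IntDvd d y) : IntDvd d (x - y) := by
  rw [IntDvd, sub_div]; exact IsIntegral.sub hx hy

theorem mul_left {d x : ℂ} (hx : IntDvd d x) {y : ℂ} (hy : IsIntegral ℤ y) :
    IntDvd d (y * x) := by
  rw [IntDvd, mul_div_assoc]; exact IsIntegral.mul hy hx

theorem sum {ι : Type*} {s : Finset ι} {d : ℂ} {f : ι → ℂ} (h : ∀ i ∈ s, IntDvd d (f i)) :
    IntDvd d (∑ i ∈ s, f i) := by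
  rw [IntDvd, Finset.sum_div]; exact IsIntegral.sum _ h

/-- Bézout; this cancels the group order introduced by Fourier inversion. -/
theorem of_mul_of_isCoprime {d x : ℂ} {m k : ℤ} (h : IntDvd d (m * x)) (hk : IntDvd d k)
    (hmk : IsCoprime m k) (hx : IsIntegral ℤ x) : IntDvd d x := by
  obtain ⟨a, b, hab⟩ := hmk
  have e : x / d = a * (m * x / d) + b * x * (k / d) := by
    have : (a : ℂ) * m + b * k = 1 := by exact_mod_cast hab
    linear_combination (-(x / d)) * this
  rw [IntDvd, e]
  exact ((isIntegral_algebraMap (R := ℤ) (x := a)).mul h).add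
    (((isIntegral_algebraMap (R := ℤ) (x := b)).mul hx).mul hk)

theorem intCast_dvd {d m : ℤ} (hd : d ≠ 0) (h : IntDvd d m) : d ∣ m := by
  have h2 : IsIntegral ℤ ((m : ℚ) / d) := by
    refine (isIntegral_algebraMap_iff (A := ℚ) (B := ℂ) (algebraMap ℚ ℂ).injective).1 ?_
    simpa [IntDvd] using h
  obtain ⟨k, hk⟩ := IsIntegrallyClosed.isIntegral_iff.1 h2
  refine ⟨k, ?_⟩
  have hd' : (d : ℚ) ≠ 0 := by exact_mod_cast hd
  rw [eq_div_iff hd'] at hk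
  have : (k : ℚ) * d = m := by simpa using hk
  rw [mul_comm]
  exact_mod_cast this.symm

theorem self {d : ℂ} : IntDvd d d := by
  by_cases h : d = 0
  · rw [h]; exact zero _
  · rw [IntDvd, div_self h]; exact isIntegral_one

theorem pow {d x : ℂ} (h : IntDvd d x) (k : ℕ) : IntDvd (d ^ k) (x ^ k) := by
  rw [IntDvd, ← div_pow]; exact IsIntegral.pow h k

end IntDvd

theorem isIntegral_of_mem_adjoin {Ω : ℂ} {m : ℕ} (hm : 0 < m) (hΩ : IsPrimitiveRoot Ω m) {x : ℂ}
    (hx : x ∈ Algebra.adjoin ℤ {Ω}) : IsIntegral ℤ x :=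
  Algebra.adjoin_le (S := integralClosure ℤ ℂ)
    (Set.singleton_subset_iff.2 (hΩ.isIntegral hm)) hx

theorem isIntegral_of_pow_eq_one {z : ℂ} {m : ℕ} (hm : 0 < m) (h : z ^ m = 1) : IsIntegral ℤ z :=
  IsIntegral.of_pow hm (h ▸ isIntegral_one)

theorem mem_adjoin_of_pow_eq_one {Ω z : ℂ} {m : ℕ} (hm : 0 < m) (hΩ : IsPrimitiveRoot Ω m)
    (h : z ^ m = 1) : z ∈ Algebra.adjoin ℤ {Ω} := by
  have : NeZero m := ⟨hm.ne'⟩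
  obtain ⟨i, -, rfl⟩ := hΩ.eq_pow_of_pow_eq_one h
  exact pow_mem (Algebra.self_mem_adjoin_singleton ℤ Ω) _

theorem IsPrimitiveRoot.intDvd_sub_one_pow {q s : ℕ} (hq : q.Prime) {ξ : ℂ}
    (hξ : IsPrimitiveRoot ξ (q ^ (s + 1))) :
    IntDvd q ((ξ - 1) ^ Nat.totient (q ^ (s + 1))) ∧
      IntDvd ((ξ - 1) ^ Nat.totient (q ^ (s + 1))) q := by
  have hpos : 0 < q ^ (s + 1) := pow_pos hq.pos _
  let ξ' : Algebra.adjoin ℤ {ξ} := ⟨ξ, Algebra.self_mem_adjoin_singleton ℤ ξ⟩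
  have hξ' : IsPrimitiveRoot ξ' (q ^ (s + 1)) := IsPrimitiveRoot.coe_submonoidClass_iff.1 hξ
  have hass := hξ'.associated_natCast_sub_one_pow hq
  have hne : ξ - 1 ≠ 0 := sub_ne_zero.2 (hξ.ne_one (Nat.one_lt_pow (by omega) hq.one_lt))
  have hq0 : (q : ℂ) ≠ 0 := by exact_mod_cast hq.ne_zero
  constructor
  · obtain ⟨y, hy⟩ := hass.dvd
    have hy' : (ξ - 1) ^ Nat.totient (q ^ (s + 1)) = q * (y : ℂ) := by
      simpa [ξ'] using congrArg Subtype.val hy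
    rw [IntDvd, hy', mul_div_cancel_left₀ _ hq0]
    exact isIntegral_of_mem_adjoin hpos hξ y.2
  · obtain ⟨y, hy⟩ := hass.symm.dvd
    have hy' : (q : ℂ) = (ξ - 1) ^ Nat.totient (q ^ (s + 1)) * (y : ℂ) := by
      simpa [ξ'] using congrArg Subtype.val hy
    rw [IntDvd, hy', mul_div_cancel_left₀ _ (pow_ne_zero _ hne)]
    exact isIntegral_of_mem_adjoin hpos hξ y.2

/-! ### Consequences of self-conjugacy for the exponent -/

theorem IsSelfConjugateMod.exists_dvd_pow_add_one {q m w : ℕ} (h : IsSelfConjugateMod q m)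
    (hw : w ∣ m) (hqw : Nat.Coprime q w) : ∃ j, j ≠ 0 ∧ w ∣ q ^ j + 1 := by
  obtain ⟨s, w₀, rfl, -, j, hj⟩ := h
  have hww : w ∣ w₀ := (Nat.Coprime.pow_left s hqw).symm.dvd_of_dvd_mul_left hw
  have h1 : w ∣ q ^ j + 1 := by
    have h2 : (w₀ : ℤ) ∣ (q : ℤ) ^ j + 1 := by
      have := hj.symm.dvd
      simpa using this
    exact_mod_cast (Int.natCast_dvd_natCast.2 hww).trans h2
  -- The Frobenius argument needs `q ^ j ≥ 2`. If `j = 0` then `w ∣ 2`, and `j = 1` works as well.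
  rcases eq_or_ne j 0 with rfl | hj0
  · refine ⟨1, one_ne_zero, ?_⟩
    have h2 : w ∣ 2 := by simpa using h1
    rcases (Nat.dvd_prime Nat.prime_two).1 h2 with rfl | rfl
    · exact one_dvd _
    · have := Nat.coprime_two_right.1 hqw
      rw [pow_one]
      exact (this.add_odd odd_one).two_dvd
  · exact ⟨j, hj0, h1⟩

/-- If `r = 2 * k + 1`, rounding up gives `q ^ (k + 1) ∣ X`, so `q ^ (2 * k + 2)` divides `N`,
against exactness. -/
theorem even_of_exactPowDvd_mul_conj {q m r : ℕ} (hq : q.Prime) (hm : 0 < m)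
    (hsc : ∃ j, j ≠ 0 ∧ m ∣ q ^ j + 1) {Ω : ℂ}
    (hΩ : IsPrimitiveRoot Ω m) {X : ℂ} (hX : X ∈ Algebra.adjoin ℤ {Ω}) {N : ℤ}
    (hN : X * conj X = N) (hr : ExactPowDvd q r N) : Even r := by
  obtain ⟨j, hj0, hj⟩ := hsc
  by_contra hodd
  obtain ⟨k, rfl⟩ := Nat.not_even_iff_odd.1 hodd
  obtain ⟨y, hy, hXy⟩ := exists_pow_mul_of_mul_conj hq hm hj hj0 hΩ hX hN hr.1
  refine hr.2 (IntDvd.intCast_dvd (pow_ne_zero _ (by exact_mod_cast hq.ne_zero)) ?_)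
  have hq0 : (q : ℂ) ≠ 0 := by exact_mod_cast hq.ne_zero
  have hy' := isIntegral_of_mem_adjoin hm hΩ hy
  have hyc : IsIntegral ℤ (conj y) := hy'.map ((Complex.conjAe : ℂ →ₐ[ℝ] ℂ).restrictScalars ℤ)
  have e : ((N : ℤ) : ℂ) / (((q : ℤ) ^ (2 * k + 1 + 1) : ℤ) : ℂ) = y * conj y := by
    rw [← hN, hXy]
    rw [map_mul, map_pow, Complex.conj_natCast, show (2 * k + 1 + 1) / 2 = k + 1 by omega]
    push_cast
    field_simp
    ring
  rw [IntDvd, e]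
  exact hy'.mul hyc

theorem intDvd_pow_of_mul_conj {q m r : ℕ} (hq : q.Prime) (hm : 0 < m)
    (hsc : IsSelfConjugateMod q m) {Ω : ℂ} (hΩ : IsPrimitiveRoot Ω m) {X : ℂ}
    (hX : X ∈ Algebra.adjoin ℤ {Ω}) {N : ℤ} (hN : X * conj X = N) (hr : (q : ℤ) ^ r ∣ N) :
    IntDvd ((q : ℂ) ^ (r / 2)) X := by
  obtain ⟨s, w, rfl, hqw, -⟩ := id hsc
  have hw : 0 < w := Nat.pos_of_mul_pos_left hm
  obtain ⟨j, hj0, hj⟩ := hsc.exists_dvd_pow_add_one (dvd_mul_left w (q ^ s)) hqw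
  have hq0 : (q : ℂ) ≠ 0 := by exact_mod_cast hq.ne_zero
  rcases s with _ | s
  · rw [pow_zero, one_mul] at hΩ
    obtain ⟨y, hy, hXy⟩ := exists_pow_mul_of_mul_conj hq hw hj hj0 hΩ hX hN hr
    have e : X / (q : ℂ) ^ (r / 2) = q ^ ((r + 1) / 2 - r / 2) * y := by
      have : (r + 1) / 2 = r / 2 + ((r + 1) / 2 - r / 2) := by omega
      rw [hXy, this, pow_add]
      field_simp
      rw [add_tsub_cancel_left, mul_comm]
    rw [IntDvd, e]
    exact (IsIntegral.pow (isIntegral_algebraMap (R := ℤ) (x := (q : ℤ))) _).mul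
      (isIntegral_of_mem_adjoin hw hΩ hy)
  · have hξ : IsPrimitiveRoot (Ω ^ w) (q ^ (s + 1)) := hΩ.pow hm (mul_comm _ _)
    obtain ⟨y, hy, hXy⟩ := exists_sub_one_pow_mul_of_mul_conj hq hw hj hj0 hΩ hξ
      (pow_mem (Algebra.self_mem_adjoin_singleton ℤ Ω) _) hX hN hr
    have h1 := (hξ.intDvd_sub_one_pow hq).1.pow (r / 2)
    set φ := Nat.totient (q ^ (s + 1))
    have hle : φ * (r / 2) ≤ (φ * r + 1) / 2 := by
      rw [Nat.le_div_iff_mul_le two_pos, mul_assoc]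
      exact (Nat.mul_le_mul_left _ (Nat.div_mul_le_self r 2)).trans (Nat.le_succ _)
    obtain ⟨k, hk⟩ := Nat.exists_eq_add_of_le hle
    have e : X = (y * (Ω ^ w - 1) ^ k) * ((Ω ^ w - 1) ^ φ) ^ (r / 2) := by
      rw [hXy, hk, pow_add, pow_mul]; ring
    rw [e]
    exact h1.mul_left ((isIntegral_of_mem_adjoin hm hΩ hy).mul
      ((((hΩ.isIntegral hm).pow w).sub isIntegral_one).pow k))

/-! ### Character sums of a nearly perfect sequence -/

theorem sum_range_add_of_periodic {M : Type*} [AddCommGroup M] {n : ℕ} {g : ℕ → M}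
    (hg : ∀ i, g (i + n) = g i) (i : ℕ) :
    ∑ d ∈ Finset.range n, g (i + d) = ∑ d ∈ Finset.range n, g d := by
  induction i with
  | zero => simp
  | succ i ih =>
    rw [← ih]
    have h1 := Finset.sum_range_succ (fun d => g (i + d)) n
    rw [Finset.sum_range_succ'] at h1
    simp only [add_zero, hg] at h1
    rw [← add_right_cancel h1]
    exact Finset.sum_congr rfl fun d _ => by congr 1; ring

theorem sum_mul_conj_sum_of_periodic {n : ℕ} {x : ℕ → ℂ} (hx : ∀ i, x (i + n) = x i) :
    (∑ i ∈ Finset.range n, x i) * conj (∑ i ∈ Finset.range n, x i)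
      = ∑ d ∈ Finset.range n, ∑ i ∈ Finset.range n, x i * conj (x (i + d)) := by
  rw [Finset.sum_comm, Finset.sum_mul]
  refine Finset.sum_congr rfl fun i _ => ?_
  rw [← Finset.mul_sum, map_sum, sum_range_add_of_periodic (g := fun i => conj (x i))]
  intro i
  rw [hx]

theorem IsPrimitiveRoot.cyclotomic_dvd_of_aeval_eq_zero {m : ℕ} (hm : 0 < m) {ζ : ℂ}
    (hζ : IsPrimitiveRoot ζ m) {P : ℤ[X]} (h : aeval ζ P = 0) : cyclotomic m ℤ ∣ P := by
  rw [cyclotomic_eq_minpoly hζ hm]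
  exact minpoly.isIntegrallyClosed_dvd (hζ.isIntegral hm) h

theorem IsPrimitiveRoot.aeval_eq_zero {m : ℕ} (hm : 0 < m) {ζ ζ' : ℂ} (hζ : IsPrimitiveRoot ζ m)
    (hζ' : IsPrimitiveRoot ζ' m) {P : ℤ[X]} (h : aeval ζ P = 0) : aeval ζ' P = 0 := by
  obtain ⟨Q, rfl⟩ := hζ.cyclotomic_dvd_of_aeval_eq_zero hm h
  rw [map_mul, cyclotomic_eq_minpoly hζ' hm, minpoly.aeval, zero_mul]

/-- The value of the `ω`-character on the sequence `i ↦ ζ ^ b i`. -/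
noncomputable def charSum (n : ℕ) (b : ℕ → ℕ) (ζ ω : ℂ) : ℂ :=
  ∑ i ∈ Finset.range n, ζ ^ b i * ω ^ i

/-- Grouping the product by the lag `d`: lag `0` contributes `n`, every other lag `γ * conj ω ^ d`.
-/
theorem charSum_mul_conj {n : ℕ} (hn : 0 < n) {γ : ℤ} {b : ℕ → ℕ} (hb : ∀ i, b (i + n) = b i)
    {ζ ω : ℂ} (hζ : ‖ζ‖ = 1)
    (hcorr : ∀ t, 1 ≤ t → t ≤ n - 1 → autocorrelation n (fun i => ζ ^ b i) t = γ)
    (hω : ω ^ n = 1) :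
    charSum n b ζ ω * conj (charSum n b ζ ω)
      = (n - γ) + γ * ∑ d ∈ Finset.range n, (conj ω) ^ d := by
  have hωn : ω * conj ω = 1 := by
    rw [Complex.mul_conj', Complex.norm_eq_one_of_pow_eq_one hω hn.ne']; simp
  have hζn : ζ * conj ζ = 1 := by rw [Complex.mul_conj', hζ]; simp
  rw [charSum, sum_mul_conj_sum_of_periodic fun i => by rw [hb, pow_add, hω, mul_one]]
  obtain ⟨n, rfl⟩ := Nat.exists_eq_succ_of_ne_zero hn.ne'
  rw [Finset.sum_range_succ', Finset.sum_range_succ' (fun d => conj ω ^ d)]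
  have h0 : ∑ i ∈ Finset.range n.succ, ζ ^ b i * ω ^ i * conj (ζ ^ b (i + 0) * ω ^ (i + 0))
      = (n.succ : ℂ) := by
    rw [Finset.sum_congr rfl (g := fun _ => (1 : ℂ))]
    · simp
    intro i _
    rw [map_mul, map_pow, map_pow, add_zero]
    calc _ = (ζ * conj ζ) ^ b i * (ω * conj ω) ^ i := by ring
      _ = 1 := by rw [hωn, hζn]; simp
  rw [h0, mul_add, Finset.mul_sum, pow_zero, mul_one]
  have h1 : ∀ d ∈ Finset.range n,
      ∑ i ∈ Finset.range n.succ, ζ ^ b i * ω ^ i * conj (ζ ^ b (i + (d + 1)) * ω ^ (i + (d + 1)))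
        = γ * (conj ω) ^ (d + 1) := by
    intro d hd
    rw [← hcorr (d + 1) (by omega) (by have := Finset.mem_range.1 hd; omega), autocorrelation,
      Finset.sum_mul]
    refine Finset.sum_congr rfl fun i _ => ?_
    rw [map_mul, map_pow conj ω, pow_add (conj ω)]
    calc _ = ζ ^ b i * conj (ζ ^ b (i + (d + 1))) * (conj ω) ^ (d + 1) * (ω * conj ω) ^ i := by ring
      _ = _ := by rw [hωn]; ring
  rw [Finset.sum_congr rfl h1]
  ring

theorem charSum_mul_conj_of_ne_one {n : ℕ} (hn : 0 < n) {γ : ℤ} {b : ℕ → ℕ}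
    (hb : ∀ i, b (i + n) = b i) {ζ ω : ℂ} (hζ : ‖ζ‖ = 1)
    (hcorr : ∀ t, 1 ≤ t → t ≤ n - 1 → autocorrelation n (fun i => ζ ^ b i) t = γ)
    (hω : ω ^ n = 1) (hω1 : ω ≠ 1) :
    charSum n b ζ ω * conj (charSum n b ζ ω) = ((n - γ : ℤ) : ℂ) := by
  rw [charSum_mul_conj hn hb hζ hcorr hω, geom_sum_eq (by
    rwa [Ne, map_eq_one_iff _ (RingHom.injective _)]), ← map_pow, hω]
  simp

theorem charSum_one_mul_conj {n : ℕ} (hn : 0 < n) {γ : ℤ} {b : ℕ → ℕ}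
    (hb : ∀ i, b (i + n) = b i) {ζ : ℂ} (hζ : ‖ζ‖ = 1)
    (hcorr : ∀ t, 1 ≤ t → t ≤ n - 1 → autocorrelation n (fun i => ζ ^ b i) t = γ) :
    charSum n b ζ 1 * conj (charSum n b ζ 1) = (((γ + 1) * n - γ : ℤ) : ℂ) := by
  rw [charSum_mul_conj hn hb hζ hcorr (one_pow _)]
  simp
  ring

/-- A nearly perfect sequence is given by exponents, and these define a nearly perfect sequence for
each choice of the primitive root of unity. -/
theorem IsPAryNPS.exists_exponents {p n : ℕ} (hp : p.Prime) {γ : ℤ} {a : ℕ → ℂ}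
    (h : IsPAryNPS p n γ a) :
    ∃ b : ℕ → ℕ, (∀ i, b i < p) ∧ (∀ i, b (i + n) = b i) ∧ ∀ ζ : ℂ, IsPrimitiveRoot ζ p →
      ∀ t, 1 ≤ t → t ≤ n - 1 → autocorrelation n (fun i => ζ ^ b i) t = γ := by
  obtain ⟨⟨hper, ζ, hζ, hpow⟩, hcorr⟩ := h
  have : NeZero p := ⟨hp.ne_zero⟩
  have hex : ∀ i, ∃ k < p, ζ ^ k = a i := fun i => by
    obtain ⟨c, hc⟩ := hpow i
    refine hζ.eq_pow_of_pow_eq_one ?_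
    rw [hc, ← zpow_natCast, ← zpow_mul, mul_comm, zpow_mul, zpow_natCast, hζ.pow_eq_one, one_zpow]
  choose b hbp hba using hex
  refine ⟨b, hbp, fun i => hζ.pow_inj (hbp _) (hbp _) (by rw [hba, hba, hper]), ?_⟩
  intro ζ' hζ' t ht htn
  -- The autocorrelation is the value at `z` of one integer polynomial (`p - b` replaces `-b`), so
  -- the relation carries over to every conjugate of `ζ`.
  have key : ∀ z : ℂ, IsPrimitiveRoot z p → autocorrelation n (fun i => z ^ b i) t
      = aeval z (∑ i ∈ Finset.range n, (X : ℤ[X]) ^ (b i + (p - b (i + t)))) := by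
    intro z hz
    rw [autocorrelation, map_sum]
    refine Finset.sum_congr rfl fun i _ => ?_
    have hz0 := hz.ne_zero hp.ne_zero
    simp only [map_pow, aeval_X]
    rw [conj_eq_inv_of_pow_eq_one hp.ne_zero hz.pow_eq_one, pow_add,
      pow_sub₀ _ hz0 (hbp _).le, hz.pow_eq_one, one_mul, inv_pow]
  have h1 : aeval ζ ((∑ i ∈ Finset.range n, (X : ℤ[X]) ^ (b i + (p - b (i + t)))) - C γ) = 0 := by
    rw [map_sub, ← key ζ hζ, aeval_C]
    simp only [hba]
    rw [show autocorrelation n (fun i => a i) t = γ from hcorr t ht htn]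
    simp
  have h2 := hζ.aeval_eq_zero hp.pos hζ' h1
  rw [map_sub, ← key ζ' hζ', aeval_C, sub_eq_zero] at h2
  simpa using h2

/-! ### Fourier inversion and divisibility -/

theorem IsPrimitiveRoot.pow_eq_pow_iff_modEq' {u : ℕ} (hu : 0 < u) {ω : ℂ}
    (hω : IsPrimitiveRoot ω u) {i j : ℕ} : ω ^ i = ω ^ j ↔ i ≡ j [MOD u] := by
  rw [hω.eq_orderOf]
  refine IsOfFinOrder.pow_eq_pow_iff_modEq ?_
  exact isOfFinOrder_iff_pow_eq_one.2 ⟨u, hu, hω.pow_eq_one⟩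

/-- Fourier inversion on a cyclic group. -/
theorem IsPrimitiveRoot.sum_inv_pow_mul_sum {u : ℕ} (hu : 0 < u) {ω : ℂ}
    (hω : IsPrimitiveRoot ω u) {ι : Type*} (S : Finset ι) (v : ι → ℂ) (e : ι → ℕ) (j : ℕ) :
    ∑ t ∈ Finset.range u, (ω⁻¹) ^ (j * t) * ∑ i ∈ S, v i * (ω ^ t) ^ e i
      = u * ∑ i ∈ S with e i ≡ j [MOD u], v i := by
  have hω0 := hω.ne_zero hu.ne'
  simp only [Finset.mul_sum]
  rw [Finset.sum_comm, Finset.sum_filter]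
  refine Finset.sum_congr rfl fun i _ => ?_
  have h1 : ∀ t ∈ Finset.range u, (ω⁻¹) ^ (j * t) * (v i * (ω ^ t) ^ e i)
      = v i * (ω ^ e i * (ω⁻¹) ^ j) ^ t := fun t _ => by ring
  rw [Finset.sum_congr rfl h1, ← Finset.mul_sum]
  have h2 : ω ^ e i * (ω⁻¹) ^ j = 1 ↔ e i ≡ j [MOD u] := by
    rw [← hω.pow_eq_pow_iff_modEq' hu, inv_pow, mul_inv_eq_one₀ (pow_ne_zero _ hω0)]
  split_ifs with h
  · rw [h2.2 h]; simp; ring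
  · rw [geom_sum_eq (mt h2.1 h), mul_pow, ← pow_mul, ← pow_mul, mul_comm (e i), mul_comm j,
      pow_mul, pow_mul, inv_pow, hω.pow_eq_one]
    simp

theorem IntDvd.sum_filter_modEq {u : ℕ} (hu : 0 < u) {ω : ℂ} (hω : IsPrimitiveRoot ω u)
    {ι : Type*} {S : Finset ι} {v : ι → ℂ} (hv : ∀ i, IsIntegral ℤ (v i)) {e : ι → ℕ} {d : ℂ}
    {k : ℤ} (hk : IntDvd d k) (huk : IsCoprime (u : ℤ) k)
    (h : ∀ t < u, IntDvd d (∑ i ∈ S, v i * (ω ^ t) ^ e i)) (j : ℕ) :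
    IntDvd d (∑ i ∈ S with e i ≡ j [MOD u], v i) := by
  refine IntDvd.of_mul_of_isCoprime ?_ hk huk (IsIntegral.sum _ fun i _ => hv i)
  rw [Int.cast_natCast, ← hω.sum_inv_pow_mul_sum hu]
  exact IntDvd.sum fun t ht => (h t (Finset.mem_range.1 ht)).mul_left
    ((hω.inv.isIntegral hu).pow _)

/-- Comparing two classes cancels the trivial character `t = 0`, whose sum is not controlled. -/
theorem IntDvd.sum_filter_modEq_sub {u : ℕ} (hu : 0 < u) {ω : ℂ} (hω : IsPrimitiveRoot ω u)
    {ι : Type*} {S : Finset ι} {v : ι → ℂ} (hv : ∀ i, IsIntegral ℤ (v i)) {e : ι → ℕ} {d : ℂ}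
    {k : ℤ} (hk : IntDvd d k) (huk : IsCoprime (u : ℤ) k)
    (h : ∀ t < u, t ≠ 0 → IntDvd d (∑ i ∈ S, v i * (ω ^ t) ^ e i)) (j j' : ℕ) :
    IntDvd d ((∑ i ∈ S with e i ≡ j [MOD u], v i) - ∑ i ∈ S with e i ≡ j' [MOD u], v i) := by
  refine IntDvd.of_mul_of_isCoprime ?_ hk huk
    ((IsIntegral.sum _ fun i _ => hv i).sub (IsIntegral.sum _ fun i _ => hv i))
  rw [Int.cast_natCast, mul_sub, ← hω.sum_inv_pow_mul_sum hu, ← hω.sum_inv_pow_mul_sum hu,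
    ← Finset.sum_sub_distrib]
  refine IntDvd.sum fun t ht => ?_
  rw [← sub_mul]
  rcases eq_or_ne t 0 with rfl | ht0
  · simpa using IntDvd.zero d
  · exact (h t (Finset.mem_range.1 ht) ht0).mul_left
      (((hω.inv.isIntegral hu).pow _).sub ((hω.inv.isIntegral hu).pow _))

/-! ### Lifting to integer polynomials -/

/-- Divisibility among algebraic integers of a value at a root of unity of prime power order lifts
to integral polynomials. -/
theorem IsPrimitiveRoot.exists_eq_mul_add_cyclotomic_mul {q s : ℕ} (hq : q.Prime) {ξ : ℂ}
    (hξ : IsPrimitiveRoot ξ (q ^ s)) {f g₀ : ℤ[X]} (hg₀ : aeval ξ g₀ ≠ 0)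
    (h : IntDvd (aeval ξ g₀) (aeval ξ f)) :
    ∃ g k : ℤ[X], f = g₀ * g + cyclotomic (q ^ s) ℤ * k := by
  have := Fact.mk hq
  have hpos : 0 < q ^ s := pow_pos hq.pos _
  have : NeZero (q ^ s) := ⟨hpos.ne'⟩
  let K := IntermediateField.adjoin ℚ {ξ}
  have hK : IsCyclotomicExtension {q ^ s} ℚ K := by
    change IsCyclotomicExtension {q ^ s} ℚ (IntermediateField.adjoin ℚ {ξ}).toSubalgebra
    rw [IntermediateField.adjoin_simple_toSubalgebra_of_isAlgebraic
      ((hξ.isIntegral hpos).tower_top (A := ℚ)).isAlgebraic]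
    exact hξ.adjoin_isCyclotomicExtension ℚ
  let z : K := IntermediateField.AdjoinSimple.gen ℚ ξ
  have hzξ : algebraMap K ℂ z = ξ := IntermediateField.AdjoinSimple.algebraMap_gen ℚ ξ
  have hz : IsPrimitiveRoot z (q ^ s) :=
    IsPrimitiveRoot.of_map_of_injective (f := algebraMap K ℂ) (by rwa [hzξ])
      (algebraMap K ℂ).injective
  have hev : ∀ P : ℤ[X], algebraMap K ℂ (aeval z P) = aeval ξ P := fun P => by
    rw [← hzξ, aeval_algebraMap_apply]
  -- `ℤ[ξ]` is the full ring of integers of `ℚ(ξ)`, so the quotient is an integer polynomial in `ξ`.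
  have hcl := IsCyclotomicExtension.Rat.isIntegralClosure_adjoin_singleton_of_prime_pow hz
  have hint : IsIntegral ℤ (aeval z f / aeval z g₀) := by
    refine (isIntegral_algebraMap_iff (B := ℂ) (algebraMap K ℂ).injective).1 ?_
    rw [map_div₀, hev, hev]
    exact h
  obtain ⟨y, hy⟩ := hcl.isIntegral_iff.1 hint
  have hymem : (y : K) ∈ Algebra.adjoin ℤ {z} := y.2
  generalize hy₀ : (y : K) = y₀ at hymem
  rw [Algebra.adjoin_singleton_eq_range_aeval] at hymem
  obtain ⟨g, hg⟩ := hymem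
  have hyg : aeval z g = aeval z f / aeval z g₀ := by
    rw [← hy]; exact hg.trans hy₀.symm
  have h0 : aeval ξ (f - g₀ * g) = 0 := by
    rw [map_sub, map_mul, ← hev g, hyg, map_div₀, hev, hev, mul_div_cancel₀ _ hg₀, sub_self]
  obtain ⟨k, hk⟩ := hξ.cyclotomic_dvd_of_aeval_eq_zero hpos h0
  exact ⟨g, k, by rw [← hk]; ring⟩

/-- The shift operator on integer sequences. -/
def seqShift : Module.End ℤ (ℕ → ℤ) := LinearMap.funLeft ℤ ℤ (· + 1)

theorem seqShift_pow_apply (m : ℕ) (φ : ℕ → ℤ) (i : ℕ) : (seqShift ^ m) φ i = φ (i + m) := by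
  induction m generalizing φ with
  | zero => simp
  | succ m ih =>
    rw [pow_succ, Module.End.mul_apply, ih, seqShift, LinearMap.funLeft_apply, add_assoc]

theorem aeval_seqShift_sum_X_pow {ι : Type*} (S : Finset ι) (m : ι → ℕ) (φ : ℕ → ℤ) (i : ℕ) :
    aeval seqShift (∑ x ∈ S, (X : ℤ[X]) ^ m x) φ i = ∑ x ∈ S, φ (i + m x) := by
  simp [map_sum, seqShift_pow_apply]

theorem aeval_seqShift_X_pow_sub_one_mul {Q : ℕ} {φ : ℕ → ℤ} (hφ : ∀ i, φ (i + Q) = φ i)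
    (h : ℤ[X]) : aeval seqShift ((X ^ Q - 1) * h) φ = 0 := by
  rw [mul_comm, map_mul, Module.End.mul_apply]
  have : aeval seqShift (X ^ Q - 1 : ℤ[X]) φ = 0 := by
    ext i
    simp [seqShift_pow_apply, hφ]
  rw [this, map_zero]

/-- Multiplying by `X ^ q ^ s - 1` turns the cyclotomic factor into `X ^ q ^ (s + 1) - 1`, which
kills `φ` when `X` acts as the shift. -/
theorem dvd_sum_sub_sum_of_eq_add_cyclotomic_mul {q s : ℕ} (hq : q.Prime) {ι : Type*}
    {S : Finset ι} {m : ι → ℕ} {c : ℤ} {g k : ℤ[X]}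
    (h : ∑ x ∈ S, (X : ℤ[X]) ^ m x = C c * g + cyclotomic (q ^ (s + 1)) ℤ * k) {φ : ℕ → ℤ}
    (hφ : ∀ i, φ (i + q ^ (s + 1)) = φ i) :
    c ∣ ∑ x ∈ S, φ (m x + q ^ s) - ∑ x ∈ S, φ (m x) := by
  have := Fact.mk hq
  have h1 : (X ^ q ^ s - 1) * ∑ x ∈ S, (X : ℤ[X]) ^ m x
      = C c * ((X ^ q ^ s - 1) * g) + (X ^ q ^ (s + 1) - 1) * k := by
    rw [h, ← cyclotomic_prime_pow_mul_X_pow_sub_one ℤ q s]; ring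
  have h2 := congrArg (fun P => aeval seqShift P φ 0) h1
  simp only [map_add, LinearMap.add_apply, Pi.add_apply] at h2
  rw [aeval_seqShift_X_pow_sub_one_mul hφ, Pi.zero_apply, add_zero] at h2
  refine ⟨aeval seqShift ((X ^ q ^ s - 1) * g) φ 0, ?_⟩
  rw [map_mul, Module.End.mul_apply, map_sub, map_pow, aeval_X, map_one, LinearMap.sub_apply,
    Pi.sub_apply, seqShift_pow_apply, aeval_seqShift_sum_X_pow, Module.End.one_apply,
    aeval_seqShift_sum_X_pow, map_mul (aeval seqShift) (C c), Module.End.mul_apply, aeval_C] at h2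
  simpa [add_comm] using h2

/-! ### Residue counts and the bound for `q ≠ p` -/

/-- The number of indices in a residue class at which the exponent sequence has a given value. -/
def residueCount (u n : ℕ) (b : ℕ → ℕ) (j k : ℕ) : ℕ :=
  (Finset.filter (fun i => i ≡ j [MOD u]) (Finset.filter (fun i => b i = k) (Finset.range n))).card

theorem card_filter_modEq {u n : ℕ} (hu : 0 < u) (hun : u ∣ n) (j : ℕ) :
    (Finset.filter (fun i => i ≡ j [MOD u]) (Finset.range n)).card = n / u := by
  rw [← Nat.count_eq_card_filter_range, Nat.count_modEq_card _ hu, Nat.mod_eq_zero_of_dvd hun]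
  simp

theorem residueCount_le {u n : ℕ} (hu : 0 < u) (hun : u ∣ n) (b : ℕ → ℕ) (j k : ℕ) :
    residueCount u n b j k ≤ n / u := by
  rw [← card_filter_modEq hu hun j, residueCount]
  exact Finset.card_le_card (Finset.filter_subset_filter _ (Finset.filter_subset _ _))

theorem sum_residueCount_mul {u n p : ℕ} {b : ℕ → ℕ} (hb : ∀ i, b i < p) (j : ℕ) {R : Type*}
    [CommRing R] (F : ℕ → R) :
    ∑ k ∈ Finset.range p, (residueCount u n b j k : R) * F k
      = ∑ i ∈ Finset.range n with i ≡ j [MOD u], F (b i) := by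
  rw [← Finset.sum_fiberwise_of_maps_to (s := Finset.filter (fun i => i ≡ j [MOD u])
    (Finset.range n)) (t := Finset.range p) (g := b) (fun i _ => Finset.mem_range.2 (hb i))]
  refine Finset.sum_congr rfl fun k _ => ?_
  rw [residueCount, Finset.filter_comm, Finset.sum_congr rfl (g := fun _ => F k)]
  · simp
  · intro i hi
    rw [(Finset.mem_filter.1 hi).2]

theorem charSum_eq_sum_residueCount {u n p : ℕ} (hu : 0 < u) {b : ℕ → ℕ} (hb : ∀ i, b i < p)
    (ζ : ℂ) {ω : ℂ} (hω : ω ^ u = 1) :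
    charSum n b ζ ω = ∑ j ∈ Finset.range u,
      (∑ k ∈ Finset.range p, (residueCount u n b j k : ℂ) * ζ ^ k) * ω ^ j := by
  rw [charSum, ← Finset.sum_fiberwise_of_maps_to (t := Finset.range u) (g := fun i => i % u)
    (fun i _ => Finset.mem_range.2 (Nat.mod_lt _ hu))]
  refine Finset.sum_congr rfl fun j hj => ?_
  rw [sum_residueCount_mul hb, Finset.sum_mul]
  have hj' : j % u = j := Nat.mod_eq_of_lt (Finset.mem_range.1 hj)
  refine Finset.sum_congr ?_ fun i hi => ?_
  · ext i; simp [Nat.ModEq, hj']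
  · have := (Finset.mem_filter.1 hi).2
    rw [pow_eq_pow_mod i hω, this, hj']

/-- A nonvanishing character sum forces the counts to vary under shifts. -/
theorem exists_residueCount_ne {u n p : ℕ} (hu : 0 < u) {b : ℕ → ℕ} (hb : ∀ i, b i < p)
    {ζ ω : ℂ} (hω : ω ^ u = 1) {h : ℕ} (hh : ω ^ h ≠ 1) (h0 : charSum n b ζ ω ≠ 0) :
    ∃ j, ∃ k < p, residueCount u n b j k ≠ residueCount u n b (j + h) k := by
  by_contra! hcon
  set G : ℕ → ℂ := fun j => (∑ k ∈ Finset.range p, (residueCount u n b j k : ℂ) * ζ ^ k) * ω ^ j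
  have hG : ∀ j, G (j + u) = G j := fun j => by
    have : ∀ k, residueCount u n b (j + u) k = residueCount u n b j k := fun k => by
      rw [residueCount, residueCount]
      congr 1
      ext
      simp only [Finset.mem_filter]
      simp [Nat.ModEq]
    simp only [G, this, pow_add, hω, mul_one]
  have hGh : ∀ j, G (h + j) = ω ^ h * G j := fun j => by
    have : ∑ k ∈ Finset.range p, (residueCount u n b (h + j) k : ℂ) * ζ ^ k
        = ∑ k ∈ Finset.range p, (residueCount u n b j k : ℂ) * ζ ^ k :=
      Finset.sum_congr rfl fun k hk => by rw [hcon j k (Finset.mem_range.1 hk), add_comm]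
    simp only [G, this, pow_add]; ring
  have h1 : charSum n b ζ ω = ∑ j ∈ Finset.range u, G j := charSum_eq_sum_residueCount hu hb ζ hω
  -- Shift-invariant counts would make the character sum equal to `ω ^ h` times itself.
  have h2 := sum_range_add_of_periodic hG h
  simp only [hGh] at h2
  rw [← Finset.mul_sum, ← h1] at h2
  exact hh (mul_right_cancel₀ h0 (by rw [h2, one_mul]))

/-- Fourier inversion in `ζ`: for `t ≠ 0` the power `ζ ^ t` is again primitive, and for `t = 0` the
sum is a vanishing geometric series since `ω ≠ 1`. -/
theorem IntDvd.sum_filter_exponent {p n : ℕ} (hp : p.Prime) {b : ℕ → ℕ} (hb : ∀ i, b i < p)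
    {ω : ℂ} (hn : 0 < n) (hω : ω ^ n = 1) (hω1 : ω ≠ 1) {d : ℂ} {c : ℤ} (hc : IntDvd d c)
    (hpc : IsCoprime (p : ℤ) c) (h : ∀ ζ, IsPrimitiveRoot ζ p → IntDvd d (charSum n b ζ ω))
    {k : ℕ} (hk : k < p) :
    IntDvd d (∑ i ∈ Finset.range n with b i = k, ω ^ i) := by
  have hζ := Complex.isPrimitiveRoot_exp p hp.ne_zero
  have := IntDvd.sum_filter_modEq hp.pos hζ (S := Finset.range n) (v := fun i => ω ^ i)
    (fun i => (isIntegral_of_pow_eq_one hn hω).pow i) (e := b) hc hpc (fun t ht => by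
      simp only [mul_comm (ω ^ _)]
      change IntDvd d (charSum n b _ ω)
      rcases eq_or_ne t 0 with rfl | ht0
      · rw [charSum]
        simp only [pow_zero, one_pow, one_mul]
        rw [geom_sum_eq hω1, hω, sub_self, zero_div]
        exact IntDvd.zero d
      · exact h _ (hζ.pow_of_coprime t
          (Nat.coprime_of_lt_prime ht0 ht hp).symm)) k
  convert this using 4 with i
  exact ⟨fun h => by rw [h], fun h => Nat.ModEq.eq_of_lt_of_lt h (hb i) hk⟩

theorem dvd_residueCount_sub_of_coprime {p q u n a : ℕ} (hp : p.Prime) (hq : q.Prime) (hqp : q ≠ p)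
    (hu : 0 < u) (hn : 0 < n) (hun : u ∣ n) (hqu : ¬ q ∣ u) {b : ℕ → ℕ} (hb : ∀ i, b i < p)
    (h : ∀ ζ ω, IsPrimitiveRoot ζ p → ω ^ u = 1 → ω ≠ 1 →
      IntDvd ((q : ℂ) ^ a) (charSum n b ζ ω)) (j j' : ℕ) {k : ℕ} (hk : k < p) :
    ((q ^ a : ℕ) : ℤ) ∣ (residueCount u n b j k : ℤ) - residueCount u n b j' k := by
  have hω := Complex.isPrimitiveRoot_exp u hu.ne'
  have hc : IntDvd ((q : ℂ) ^ a) ((q ^ a : ℕ) : ℤ) := by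
    push_cast; exact IntDvd.self
  have hpc : IsCoprime (p : ℤ) ((q ^ a : ℕ) : ℤ) :=
    Nat.isCoprime_iff_coprime.2 (((Nat.coprime_primes hp hq).2 hqp.symm).pow_right a)
  have huc : IsCoprime (u : ℤ) ((q ^ a : ℕ) : ℤ) :=
    Nat.isCoprime_iff_coprime.2 (((Nat.Prime.coprime_iff_not_dvd hq).2 hqu).symm.pow_right a)
  have := IntDvd.sum_filter_modEq_sub hu hω (S := Finset.filter (fun i => b i = k) (Finset.range n))
    (v := fun _ => 1) (fun _ => isIntegral_one) (e := id) hc huc (fun t ht ht0 => by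
      have h1 : (Complex.exp (2 * Real.pi * Complex.I / u) ^ t) ^ u = 1 := by
        rw [pow_right_comm, hω.pow_eq_one, one_pow]
      have h2 := hω.pow_ne_one_of_pos_of_lt ht0 ht
      obtain ⟨c, rfl⟩ := hun
      simp only [one_mul, id]
      exact IntDvd.sum_filter_exponent hp hb hn (by rw [pow_mul, h1, one_pow]) h2 hc hpc
        (fun ζ hζ => h ζ _ hζ h1 h2) hk) j j'
  refine IntDvd.intCast_dvd (by exact_mod_cast (pow_pos hq.pos a).ne') ?_
  simpa [residueCount] using this

/-- Only the order `w` prime to `q` can be inverted modulo `q ^ a`. The remaining part, of order `q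
^ (s + 1)`, is treated by polynomial lifting, which compares classes at distance `u / q = w * q ^
s`. -/
theorem dvd_residueCount_sub_of_ramified {p q s w n a : ℕ} (hp : p.Prime) (hq : q.Prime)
    (hqp : q ≠ p) (hw : 0 < w) (hn : 0 < n) (hun : q ^ (s + 1) * w ∣ n) (hqw : q.Coprime w)
    {b : ℕ → ℕ} (hb : ∀ i, b i < p)
    (h : ∀ ζ ω, IsPrimitiveRoot ζ p → ω ^ (q ^ (s + 1) * w) = 1 → ω ≠ 1 →
      IntDvd ((q : ℂ) ^ a) (charSum n b ζ ω)) (j : ℕ) {k : ℕ} (hk : k < p) :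
    ((q ^ a : ℕ) : ℤ) ∣ (residueCount (q ^ (s + 1) * w) n b j k : ℤ)
      - residueCount (q ^ (s + 1) * w) n b (j + w * q ^ s) k := by
  obtain ⟨u, hu_def⟩ : ∃ u, q ^ (s + 1) * w = u := ⟨_, rfl⟩
  rw [hu_def] at h hun ⊢
  have hu : 0 < u := hu_def ▸ Nat.mul_pos (pow_pos hq.pos _) hw
  have hω := Complex.isPrimitiveRoot_exp u hu.ne'
  set ω := Complex.exp (2 * Real.pi * Complex.I / u)
  have hω₁ : IsPrimitiveRoot (ω ^ q ^ (s + 1)) w := hω.pow hu hu_def.symm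
  have hξ : IsPrimitiveRoot (ω ^ w) (q ^ (s + 1)) := hω.pow hu (by rw [← hu_def, mul_comm])
  have hc : IntDvd ((q : ℂ) ^ a) ((q ^ a : ℕ) : ℤ) := by
    push_cast; exact IntDvd.self
  have hpc : IsCoprime (p : ℤ) ((q ^ a : ℕ) : ℤ) :=
    Nat.isCoprime_iff_coprime.2 (((Nat.coprime_primes hp hq).2 hqp.symm).pow_right a)
  have hwc : IsCoprime (w : ℤ) ((q ^ a : ℕ) : ℤ) :=
    Nat.isCoprime_iff_coprime.2 (hqw.symm.pow_right a)
  set S := Finset.filter (fun i => b i = k) (Finset.range n) with hS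
  have h1 := IntDvd.sum_filter_modEq hw hω₁ (S := S) (v := fun i => ω ^ i)
    (fun i => (hω.isIntegral hu).pow i) (e := id) hc hwc (fun t _ => by
      have e : ∀ i, ω ^ i * ((ω ^ q ^ (s + 1)) ^ t) ^ id i = (ω ^ (1 + q ^ (s + 1) * t)) ^ i :=
        fun i => by simp only [id]; ring
      simp only [e]
      have h1 : (ω ^ (1 + q ^ (s + 1) * t)) ^ u = 1 := by
        rw [pow_right_comm, hω.pow_eq_one, one_pow]
      -- The exponent is `1` modulo `q`, so the trivial character never occurs among these twists.
      have h2 : ω ^ (1 + q ^ (s + 1) * t) ≠ 1 := by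
        rw [Ne, hω.pow_eq_one_iff_dvd]
        intro hd
        have hqd : q ∣ 1 + q ^ (s + 1) * t :=
          ((dvd_pow_self q (Nat.succ_ne_zero s)).trans (hu_def ▸ dvd_mul_right _ _)).trans hd
        have := (Nat.dvd_add_left ((dvd_pow_self q (Nat.succ_ne_zero s)).mul_right t)).1 hqd
        exact hq.one_lt.ne' (Nat.dvd_one.1 this)
      obtain ⟨c, rfl⟩ := hun
      exact IntDvd.sum_filter_exponent hp hb hn (by rw [pow_mul, h1, one_pow]) h2 hc hpc
        (fun ζ hζ => h ζ _ hζ h1 h2) hk) j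
  set S' := Finset.filter (fun i => id i ≡ j [MOD w]) S with hS'
  have hmem : ∀ i ∈ S', i = j % w + w * (i / w) := fun i hi => by
    have : i % w = j % w := (Finset.mem_filter.1 hi).2
    rw [← this, Nat.mod_add_div]
  have h2 : IntDvd ((q : ℂ) ^ a) (∑ i ∈ S', (ω ^ w) ^ (i / w)) := by
    have e : ∑ i ∈ S', (ω ^ w) ^ (i / w) = (ω⁻¹) ^ (j % w) * ∑ i ∈ S', ω ^ i := by
      rw [Finset.mul_sum]
      refine Finset.sum_congr rfl fun i hi => ?_
      conv_rhs => rw [hmem i hi, pow_add, ← mul_assoc, ← mul_pow,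
        inv_mul_cancel₀ (hω.ne_zero hu.ne'), one_pow, one_mul, pow_mul]
    rw [e]
    exact h1.mul_left ((hω.inv.isIntegral hu).pow _)
  obtain ⟨g, l, hgl⟩ := hξ.exists_eq_mul_add_cyclotomic_mul hq (g₀ := C ((q ^ a : ℕ) : ℤ))
    (f := ∑ i ∈ S', X ^ (i / w)) (by simp [hq.ne_zero]) (by simpa using h2)
  -- The test function selects the class of `j + w * q ^ s`; its shift by `q ^ s` selects the class
  -- of `j`.
  have h3 := dvd_sum_sub_sum_of_eq_add_cyclotomic_mul hq hgl
    (φ := fun m => if j % w + w * m ≡ j + w * q ^ s [MOD u] then 1 else 0) (fun i => by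
      have : j % w + w * (i + q ^ (s + 1)) = j % w + w * i + u := by rw [← hu_def]; ring
      exact if_congr (by rw [this, Nat.ModEq, Nat.add_mod_right, Nat.ModEq]) rfl rfl)
  have hwu : w ∣ u := hu_def ▸ dvd_mul_left _ _
  have h4 : ∑ i ∈ S', (if j % w + w * (i / w + q ^ s) ≡ j + w * q ^ s [MOD u] then (1 : ℤ) else 0)
      = residueCount u n b j k := by
    rw [Finset.sum_boole, residueCount, ← hS]
    congr 2
    ext i
    simp only [Finset.mem_filter, hS', id]
    constructor
    · rintro ⟨⟨hi, hij⟩, hm⟩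
      refine ⟨hi, ?_⟩
      rw [mul_add, ← add_assoc, ← hmem i (Finset.mem_filter.2 ⟨hi, hij⟩)] at hm
      exact Nat.ModEq.add_right_cancel' _ hm
    · rintro ⟨hi, hij⟩
      have hij' := hij.of_dvd hwu
      refine ⟨⟨hi, hij'⟩, ?_⟩
      rw [mul_add, ← add_assoc, ← hmem i (Finset.mem_filter.2 ⟨hi, hij'⟩)]
      exact hij.add_right _
  have h5 : ∑ i ∈ S', (if j % w + w * (i / w) ≡ j + w * q ^ s [MOD u] then (1 : ℤ) else 0)
      = residueCount u n b (j + w * q ^ s) k := by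
    rw [Finset.sum_boole, residueCount, ← hS]
    congr 2
    ext i
    simp only [Finset.mem_filter, hS', id]
    constructor
    · rintro ⟨⟨hi, hij⟩, hm⟩
      refine ⟨hi, ?_⟩
      rwa [← hmem i (Finset.mem_filter.2 ⟨hi, hij⟩)] at hm
    · rintro ⟨hi, hij⟩
      have hij' : i ≡ j [MOD w] := by
        have := hij.of_dvd hwu
        rwa [Nat.ModEq, Nat.add_mul_mod_self_left] at this
      refine ⟨⟨hi, hij'⟩, ?_⟩
      rwa [← hmem i (Finset.mem_filter.2 ⟨hi, hij'⟩)]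
  rwa [h4, h5] at h3

theorem le_of_dvd_natCast_sub {c m x y : ℕ} (h : (c : ℤ) ∣ (x : ℤ) - y) (hxy : x ≠ y) (hx : x ≤ m)
    (hy : y ≤ m) : c ≤ m := by
  have h0 : (x : ℤ) - y ≠ 0 := sub_ne_zero.2 (by exact_mod_cast hxy)
  have := Int.le_of_dvd (abs_pos.2 h0) ((dvd_abs _ _).2 h)
  have h2 : |(x : ℤ) - y| ≤ m := abs_le.2 ⟨by omega, by omega⟩
  exact_mod_cast this.trans h2

/-- The bound on a prime power dividing all nontrivial character sums of a `p`-ary sequence, for a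
prime different from `p`. -/
theorem pow_le_div_of_intDvd_charSum {p q u n a : ℕ} (hp : p.Prime) (hq : q.Prime) (hqp : q ≠ p)
    (hu : 1 < u) (hn : 0 < n) (hun : u ∣ n) {b : ℕ → ℕ} (hb : ∀ i, b i < p)
    (h : ∀ ζ ω, IsPrimitiveRoot ζ p → ω ^ u = 1 → ω ≠ 1 →
      IntDvd ((q : ℂ) ^ a) (charSum n b ζ ω))
    (h0 : ∀ ζ ω, IsPrimitiveRoot ζ p → ω ^ u = 1 → ω ≠ 1 → charSum n b ζ ω ≠ 0) :
    q ^ a ≤ n / u := by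
  have hu0 : 0 < u := by omega
  have hω := Complex.isPrimitiveRoot_exp u hu0.ne'
  have h1 := h0 _ _ (Complex.isPrimitiveRoot_exp p hp.ne_zero) hω.pow_eq_one (hω.ne_one hu)
  obtain ⟨s, w, hqw, hsw⟩ := Nat.exists_eq_pow_mul_and_not_dvd hu0.ne' q hq.ne_one
  rcases s with _ | s
  · rw [pow_zero, one_mul] at hsw
    obtain ⟨j, k, hk, hne⟩ := exists_residueCount_ne hu0 hb hω.pow_eq_one (h := 1)
      (by rw [pow_one]; exact hω.ne_one hu) h1
    exact le_of_dvd_natCast_sub (dvd_residueCount_sub_of_coprime hp hq hqp hu0 hn hun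
      (by rwa [hsw]) hb h _ _ hk) hne (residueCount_le hu0 hun _ _ _)
      (residueCount_le hu0 hun _ _ _)
  · have hw : 0 < w := Nat.pos_of_ne_zero fun h => hqw (h ▸ dvd_zero q)
    have hlt : w * q ^ s < u := by
      rw [hsw, pow_succ, mul_comm, mul_assoc, mul_comm q]
      exact Nat.mul_lt_mul_of_pos_left ((lt_mul_iff_one_lt_right hw).2 hq.one_lt)
        (pow_pos hq.pos s)
    obtain ⟨j, k, hk, hne⟩ := exists_residueCount_ne hu0 hb hω.pow_eq_one (h := w * q ^ s)
      (hω.pow_ne_one_of_pos_of_lt (Nat.mul_pos hw (pow_pos hq.pos s)).ne' hlt) h1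
    subst hsw
    exact le_of_dvd_natCast_sub (dvd_residueCount_sub_of_ramified hp hq hqp hw hn hun
      ((Nat.Prime.coprime_iff_not_dvd hq).2 hqw) hb h _ hk) hne (residueCount_le hu0 hun _ _ _)
      (residueCount_le hu0 hun _ _ _)

/-! ### The bound for the prime `p` -/

/-- A nonzero polynomial of degree less than the characteristic that vanishes to order `t` at `1`
has more than `t` nonzero coefficients. -/
theorem lt_card_support_of_X_sub_one_pow_dvd {p : ℕ} [Fact p.Prime] (t : ℕ) :
    ∀ f : (ZMod p)[X], f ≠ 0 → f.natDegree < p → (X - 1) ^ t ∣ f → t < f.support.card := by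
  induction t with
  | zero => exact fun f hf _ _ => Finset.card_pos.2 (nonempty_support_iff.2 hf)
  | succ t ih =>
    intro f hf hdeg hdvd
    obtain ⟨m, hm⟩ := nonempty_support_iff.2 hf
    -- `X * d/dX - m` kills exactly the coefficient at `m`, the degree being below `p`, and costs
    -- one order of vanishing at `1`.
    set g := X * derivative f - C (m : ZMod p) * f with hg
    have hcoeff : ∀ i, g.coeff i = ((i : ZMod p) - m) * f.coeff i := fun i => by
      rw [hg, coeff_sub, coeff_C_mul]
      rcases i with _ | i
      · simp
      · rw [coeff_X_mul, coeff_derivative]; push_cast; ring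
    have hlt : ∀ i ∈ f.support, i < p := fun i hi => (le_natDegree_of_mem_supp i hi).trans_lt hdeg
    have hsupp : g.support = f.support.erase m := by
      ext i
      rw [mem_support_iff, hcoeff, Finset.mem_erase, mul_ne_zero_iff, mem_support_iff, sub_ne_zero]
      refine and_congr_left fun hi => not_congr ⟨fun h => ?_, fun h => by rw [h]⟩
      exact Nat.ModEq.eq_of_lt_of_lt ((ZMod.natCast_eq_natCast_iff _ _ _).1 h)
        (hlt i (mem_support_iff.2 hi)) (hlt m hm)
    have hg0 : g ≠ 0 := by
      intro h0
      have hs : f.support ⊆ {m} := by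
        rw [h0, support_zero] at hsupp
        intro i hi
        by_contra him
        exact Finset.notMem_empty i (hsupp ▸ Finset.mem_erase.2 ⟨by simpa using him, hi⟩)
      have h1 : f.eval 1 = 0 := by
        obtain ⟨k, hk⟩ := (dvd_pow_self (X - 1) (Nat.succ_ne_zero t)).trans hdvd
        rw [hk]; simp
      rw [eval_eq_sum, sum_def, Finset.sum_subset hs (fun i _ hi => by
        rw [notMem_support_iff.1 hi, zero_mul])] at h1
      exact mem_support_iff.1 hm (by simpa using h1)
    have hgd : g.natDegree < p := by
      have := hlt g.natDegree (Finset.mem_of_mem_erase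
        (hsupp ▸ natDegree_mem_support_of_nonzero hg0))
      exact this
    have hgdvd : (X - 1) ^ t ∣ g := by
      obtain ⟨k, hk⟩ := hdvd
      refine dvd_sub (Dvd.dvd.mul_left ?_ _) (Dvd.dvd.mul_left ?_ _)
      · rw [hk, derivative_mul, derivative_pow]
        refine dvd_add (Dvd.dvd.mul_right ?_ _) ((pow_dvd_pow _ (Nat.le_succ t)).mul_right _)
        exact (Dvd.dvd.mul_left dvd_rfl _).mul_right _
      · exact (pow_dvd_pow _ (Nat.le_succ t)).trans ⟨k, hk⟩
    have := ih g hg0 hgd hgdvd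
    rw [hsupp, Finset.card_erase_of_mem hm] at this
    omega

theorem coeff_sum_range_C_mul_X_pow {R : Type*} [Semiring R] (p : ℕ) (d : ℕ → R) (i : ℕ) :
    (∑ k ∈ Finset.range p, C (d k) * X ^ k).coeff i = if i < p then d i else 0 := by
  simp [coeff_C_mul, coeff_X_pow]

theorem natDegree_sum_range_C_mul_X_pow_lt {R : Type*} [Semiring R] {p : ℕ} (hp : 0 < p)
    (d : ℕ → R) : (∑ k ∈ Finset.range p, C (d k) * X ^ k).natDegree < p := by
  rw [Nat.lt_iff_le_pred hp]
  refine natDegree_sum_le_of_forall_le _ _ fun k hk => (natDegree_C_mul_X_pow_le _ _).trans ?_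
  exact Nat.le_pred_of_lt (Finset.mem_range.1 hk)

/-- Modulo `c`, a polynomial of degree below `p` is divisible by the monic `X ^ p - 1`, hence zero.
-/
theorem dvd_of_X_pow_sub_one_dvd_sub {p : ℕ} (hp : 0 < p) {c : ℤ} {d : ℕ → ℤ} {G : ℤ[X]}
    (h : X ^ p - 1 ∣ (∑ k ∈ Finset.range p, C (d k) * X ^ k) - C c * G) {k : ℕ} (hk : k < p) :
    c ∣ d k := by
  set I := Ideal.span {c}
  have hc : Ideal.Quotient.mk I c = 0 :=
    Ideal.Quotient.eq_zero_iff_mem.2 (Ideal.mem_span_singleton_self c)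
  rw [← Ideal.mem_span_singleton, ← Ideal.Quotient.eq_zero_iff_mem]
  by_contra hne
  have : Nontrivial (ℤ ⧸ I) := ⟨_, _, hne⟩
  have h1 := Polynomial.map_dvd (Ideal.Quotient.mk I) h
  simp only [Polynomial.map_sub, Polynomial.map_sum, Polynomial.map_mul, map_C,
    Polynomial.map_pow, map_X, Polynomial.map_one, hc, C_0, zero_mul, sub_zero] at h1
  have hm : (X ^ p - 1 : (ℤ ⧸ I)[X]).Monic := monic_X_pow_sub_C 1 hp.ne'
  refine hm.not_dvd_of_natDegree_lt ?_ ?_ h1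
  · intro h0
    have := congrArg (fun P => coeff P k) h0
    simp only [coeff_sum_range_C_mul_X_pow p (fun k => Ideal.Quotient.mk I (d k)), if_pos hk,
      coeff_zero] at this
    exact hne this
  · have : (X ^ p - 1 : (ℤ ⧸ I)[X]).natDegree = p := natDegree_X_pow_sub_C
    rw [this]
    exact natDegree_sum_range_C_mul_X_pow_lt hp _

/-- A nonzero combination of `p`-th roots of unity with coefficient sum zero that is divisible by
`p ^ a * (ζ - 1) ^ t` has large coefficients. -/
theorem mul_le_sum_abs_of_intDvd {p a t : ℕ} (hp : p.Prime) (ht : 1 ≤ t) (htp : t < p) {ζ : ℂ}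
    (hζ : IsPrimitiveRoot ζ p) {d : ℕ → ℤ} (hd : ∑ k ∈ Finset.range p, d k = 0)
    (hd0 : ∃ k < p, d k ≠ 0)
    (h : IntDvd ((p : ℂ) ^ a * (ζ - 1) ^ t) (∑ k ∈ Finset.range p, (d k : ℂ) * ζ ^ k)) :
    (p : ℤ) ^ a * (t + 1) ≤ ∑ k ∈ Finset.range p, |d k| := by
  have := Fact.mk hp
  have hpa : (p : ℤ) ^ a ≠ 0 := pow_ne_zero _ (by exact_mod_cast hp.ne_zero)
  have hpa' : (0 : ℤ) < (p : ℤ) ^ a := pow_pos (by exact_mod_cast hp.pos) a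
  have hζ1 : ζ - 1 ≠ 0 := sub_ne_zero.2 (hζ.ne_one hp.one_lt)
  have hev : aeval ζ (C ((p : ℤ) ^ a) * (X - 1) ^ t) = (p : ℂ) ^ a * (ζ - 1) ^ t := by simp
  obtain ⟨g, k, hgk⟩ := IsPrimitiveRoot.exists_eq_mul_add_cyclotomic_mul (s := 1) hp
    (by rwa [pow_one]) (f := ∑ k ∈ Finset.range p, C (d k) * X ^ k)
    (g₀ := C ((p : ℤ) ^ a) * (X - 1) ^ t)
    (by rw [hev]; exact mul_ne_zero (by exact_mod_cast hpa) (pow_ne_zero _ hζ1))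
    (by rw [hev]; simpa using h)
  rw [pow_one] at hgk
  -- At `1` everything but `p * k(1)` vanishes (`t ≥ 1`, coefficient sum zero). So `X - 1 ∣ k`, and
  -- the relation holds modulo `X ^ p - 1`.
  have hk1 : k.eval 1 = 0 := by
    have := congrArg (eval 1) hgk
    simp only [eval_finsetSum, eval_mul, eval_C, eval_pow, eval_X, one_pow, mul_one, hd, eval_add,
      eval_sub, eval_one, sub_self, zero_pow (by omega : t ≠ 0), mul_zero, zero_mul, zero_add,
      eval_one_cyclotomic_prime] at this
    exact (mul_eq_zero.1 this.symm).resolve_left (by exact_mod_cast hp.ne_zero)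
  obtain ⟨l, rfl⟩ := dvd_iff_isRoot.2 hk1
  have hmain : (∑ k ∈ Finset.range p, C (d k) * X ^ k)
      = C ((p : ℤ) ^ a) * ((X - 1) ^ t * g) + (X ^ p - 1) * l := by
    have := cyclotomic_prime_mul_X_sub_one ℤ p
    rw [hgk, ← this, C_1]; ring
  have hz : ∀ i, ∃ z, i < p → d i = (p : ℤ) ^ a * z := fun i => by
    by_cases hi : i < p
    · obtain ⟨z, hz⟩ := dvd_of_X_pow_sub_one_dvd_sub hp.pos (G := (X - 1) ^ t * g)
        ⟨l, by rw [hmain]; ring⟩ hi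
      exact ⟨z, fun _ => hz⟩
    · exact ⟨0, fun h => absurd h hi⟩
  choose z hz using hz
  have hZ : (∑ k ∈ Finset.range p, C (d k) * X ^ k)
      = C ((p : ℤ) ^ a) * ∑ k ∈ Finset.range p, C (z k) * X ^ k := by
    rw [Finset.mul_sum]
    exact Finset.sum_congr rfl fun i hi => by
      rw [hz i (Finset.mem_range.1 hi), C_mul, mul_assoc]
  have hdvd : X ^ p - 1 ∣ (∑ k ∈ Finset.range p, C (z k) * X ^ k) - (X - 1) ^ t * g := by
    have hm : (X ^ p - 1 : ℤ[X]).Monic := monic_X_pow_sub_C 1 hp.ne_zero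
    have h1 : X ^ p - 1 ∣ (p : ℤ) ^ a •
        ((∑ k ∈ Finset.range p, C (z k) * X ^ k) - (X - 1) ^ t * g) := by
      rw [smul_eq_C_mul, mul_sub, ← hZ, hmain]
      exact ⟨l, by ring⟩
    rw [← modByMonic_eq_zero_iff_dvd hm] at h1 ⊢
    rw [smul_modByMonic] at h1
    exact (smul_eq_zero.1 h1).resolve_left hpa
  set Z : (ZMod p)[X] := ∑ k ∈ Finset.range p, C (z k : ZMod p) * X ^ k with hZdef
  have hZdvd : (X - 1) ^ t ∣ Z := by
    have h1 := Polynomial.map_dvd (Int.castRingHom (ZMod p)) hdvd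
    have h2 : Polynomial.map (Int.castRingHom (ZMod p)) (X ^ p - 1) = (X - 1) ^ p := by
      rw [Polynomial.map_sub, Polynomial.map_pow, map_X, Polynomial.map_one, sub_pow_char, one_pow]
    have h3 : Polynomial.map (Int.castRingHom (ZMod p)) (∑ k ∈ Finset.range p, C (z k) * X ^ k)
        = Z := by
      simp only [Polynomial.map_sum, Polynomial.map_mul, map_C, Polynomial.map_pow, map_X, hZdef]
      rfl
    rw [h2, Polynomial.map_sub, Polynomial.map_mul, h3, Polynomial.map_pow, Polynomial.map_sub,
      map_X, Polynomial.map_one] at h1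
    exact (dvd_sub_left (dvd_mul_right _ _)).1 ((pow_dvd_pow (X - 1) htp.le).trans h1)
  have habs : ∀ i < p, |d i| = (p : ℤ) ^ a * |z i| := fun i hi => by
    rw [hz i hi, abs_mul, abs_of_pos hpa']
  -- If every `z i` is divisible by `p`, one nonzero coefficient already has size `p ^ a * p`,
  -- enough because `t < p`.
  by_cases hZ0 : Z = 0
  · obtain ⟨i, hi, hdi⟩ := hd0
    have hpz : (p : ℤ) ∣ z i := by
      rw [← ZMod.intCast_zmod_eq_zero_iff_dvd]
      have := congrArg (fun P => coeff P i) hZ0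
      simpa only [hZdef, coeff_sum_range_C_mul_X_pow p (fun k => (z k : ZMod p)), if_pos hi,
        coeff_zero] using this
    have hzi : z i ≠ 0 := fun h0 => hdi (by rw [hz i hi, h0, mul_zero])
    have h1 : (p : ℤ) ≤ |z i| := Int.le_of_dvd (abs_pos.2 hzi) ((dvd_abs _ _).2 hpz)
    calc (p : ℤ) ^ a * (t + 1) ≤ (p : ℤ) ^ a * |z i| :=
          mul_le_mul_of_nonneg_left (le_trans (by exact_mod_cast htp) h1) hpa'.le
      _ = |d i| := (habs i hi).symm
      _ ≤ _ := Finset.single_le_sum (f := fun k => |d k|) (fun _ _ => abs_nonneg _)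
          (Finset.mem_range.2 hi)
  · have hcard := lt_card_support_of_X_sub_one_pow_dvd t Z hZ0
      (natDegree_sum_range_C_mul_X_pow_lt hp.pos _) hZdvd
    have hmem : ∀ i ∈ Z.support, i < p ∧ z i ≠ 0 := fun i hi => by
      rw [mem_support_iff, hZdef,
        coeff_sum_range_C_mul_X_pow p (fun k => (z k : ZMod p))] at hi
      split_ifs at hi with hip
      · exact ⟨hip, fun h0 => hi (by rw [h0, Int.cast_zero])⟩
      · exact absurd rfl hi
    calc (p : ℤ) ^ a * (t + 1) ≤ (p : ℤ) ^ a * Z.support.card :=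
          mul_le_mul_of_nonneg_left (by exact_mod_cast hcard) hpa'.le
      _ = ∑ i ∈ Z.support, (p : ℤ) ^ a := by rw [Finset.sum_const, nsmul_eq_mul, mul_comm]
      _ ≤ ∑ i ∈ Z.support, |d i| := Finset.sum_le_sum fun i hi => by
          rw [habs i (hmem i hi).1]
          exact le_mul_of_one_le_right hpa'.le (Int.one_le_abs (hmem i hi).2)
      _ ≤ _ := Finset.sum_le_sum_of_subset_of_nonneg
          (fun i hi => Finset.mem_range.2 (hmem i hi).1) fun _ _ _ => abs_nonneg _

/-- The bound on a power of `p` dividing the squared absolute values of the nontrivial character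
sums of a `p`-ary sequence. -/
theorem pow_mul_le_of_charSum_mul_conj {p u n a t r : ℕ} (hp : p.Prime) (hu : 1 < u)
    (hun : u ∣ n) (hpu : ¬ p ∣ u) (hsc : IsSelfConjugateMod p u) {b : ℕ → ℕ} (hb : ∀ i, b i < p)
    {N : ℤ} (hN0 : N ≠ 0) (hr : (p : ℤ) ^ r ∣ N)
    (h : ∀ ζ ω, IsPrimitiveRoot ζ p → ω ^ u = 1 → ω ≠ 1 →
      charSum n b ζ ω * conj (charSum n b ζ ω) = N)
    (ht : 1 ≤ t) (htp : t < p) (hat : 2 * ((p - 1) * a + t) ≤ (p - 1) * r + 1) :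
    p ^ a * (t + 1) ≤ 2 * (n / u) := by
  have hu0 : 0 < u := by omega
  have hω := Complex.isPrimitiveRoot_exp u hu0.ne'
  have hζ := Complex.isPrimitiveRoot_exp p hp.ne_zero
  set ω := Complex.exp (2 * Real.pi * Complex.I / u)
  set ζ := Complex.exp (2 * Real.pi * Complex.I / p)
  have hpu' : p.Coprime u := (Nat.Prime.coprime_iff_not_dvd hp).2 hpu
  obtain ⟨j₀, hj₀, hj⟩ := hsc.exists_dvd_pow_add_one dvd_rfl hpu'
  have hM : 0 < p ^ (0 + 1) * u := Nat.mul_pos (pow_pos hp.pos _) hu0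
  have hΩ := Complex.isPrimitiveRoot_exp (p ^ (0 + 1) * u) hM.ne'
  have hζ' : IsPrimitiveRoot ζ (p ^ (0 + 1)) := by simpa using hζ
  have hζΩ := mem_adjoin_of_pow_eq_one hM hΩ (z := ζ)
    (by rw [pow_mul, hζ'.pow_eq_one, one_pow])
  have hφ : Nat.totient (p ^ (0 + 1)) = p - 1 := by simp [Nat.totient_prime hp]
  have hζi : IsIntegral ℤ (ζ - 1) := (hζ.isIntegral hp.pos).sub isIntegral_one
  have hζ1 : ζ - 1 ≠ 0 := sub_ne_zero.2 (hζ.ne_one hp.one_lt)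
  have hp0 : (p : ℂ) ≠ 0 := by exact_mod_cast hp.ne_zero
  obtain ⟨hpπ, hπp⟩ := hζ'.intDvd_sub_one_pow hp
  rw [hφ] at hpπ hπp
  have hdvd : ∀ ω', ω' ^ u = 1 → ω' ≠ 1 →
      IntDvd ((p : ℂ) ^ a * (ζ - 1) ^ t) (charSum n b ζ ω') := fun ω' hω' hω'1 => by
    have hω'Ω := mem_adjoin_of_pow_eq_one hM hΩ (z := ω')
      (by rw [mul_comm, pow_mul, hω', one_pow])
    obtain ⟨y, hy, hXy⟩ := exists_sub_one_pow_mul_of_mul_conj hp hu0 hj hj₀ hΩ hζ' hζΩ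
      (X := charSum n b ζ ω')
      (sum_mem fun i _ => mul_mem (pow_mem hζΩ _) (pow_mem hω'Ω _)) (h ζ ω' hζ hω' hω'1) hr
    rw [hφ] at hXy
    have hle : (p - 1) * a + t ≤ ((p - 1) * r + 1) / 2 := by omega
    obtain ⟨m, hm⟩ := Nat.exists_eq_add_of_le hle
    have e : charSum n b ζ ω' / ((p : ℂ) ^ a * (ζ - 1) ^ t)
        = (((ζ - 1) ^ (p - 1)) / p) ^ a * ((ζ - 1) ^ m * y) := by
      rw [hXy, hm, pow_add, pow_add, pow_mul, div_pow]
      field_simp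
    rw [IntDvd, e]
    exact (IsIntegral.pow hpπ a).mul ((hζi.pow m).mul (isIntegral_of_mem_adjoin hM hΩ hy))
  -- `(ζ - 1) ^ t` divides `p ^ t`, so `p ^ (a + t)` is an integer multiple of the divisor and prime
  -- to `u`.
  have hc : IntDvd ((p : ℂ) ^ a * (ζ - 1) ^ t) ((p ^ (a + t) : ℕ) : ℤ) := by
    have e : (((p ^ (a + t) : ℕ) : ℤ) : ℂ) / ((p : ℂ) ^ a * (ζ - 1) ^ t)
        = (p / (ζ - 1) ^ (p - 1)) ^ t * ((ζ - 1) ^ (p - 2)) ^ t := by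
      have : p - 1 = p - 2 + 1 := by have := hp.two_le; omega
      rw [this, pow_succ (ζ - 1)]
      push_cast
      rw [pow_add, div_pow, mul_pow]
      field_simp
    rw [IntDvd, e]
    exact (IsIntegral.pow hπp t).mul ((hζi.pow _).pow t)
  have huc : IsCoprime (u : ℤ) ((p ^ (a + t) : ℕ) : ℤ) :=
    Nat.isCoprime_iff_coprime.2 (hpu'.symm.pow_right _)
  have hne : charSum n b ζ ω ≠ 0 := fun h0 => by
    have := h ζ ω hζ hω.pow_eq_one (hω.ne_one hu)
    rw [h0, zero_mul] at this
    exact hN0 (by exact_mod_cast this.symm)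
  obtain ⟨j, k, hk, hjk⟩ := exists_residueCount_ne hu0 hb hω.pow_eq_one (h := 1)
    (by rw [pow_one]; exact hω.ne_one hu) hne
  have hdiff := IntDvd.sum_filter_modEq_sub hu0 hω (S := Finset.range n) (v := fun i => ζ ^ b i)
    (fun i => (hζ.isIntegral hp.pos).pow _) (e := id) hc huc (fun t ht ht0 =>
      hdvd _ (by rw [pow_right_comm, hω.pow_eq_one, one_pow])
        (hω.pow_ne_one_of_pos_of_lt ht0 ht)) j (j + 1)
  simp only [id] at hdiff
  rw [← sum_residueCount_mul hb j (fun k => ζ ^ k),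
    ← sum_residueCount_mul hb (j + 1) (fun k => ζ ^ k), ← Finset.sum_sub_distrib] at hdiff
  have hsum : ∀ j, ∑ k ∈ Finset.range p, (residueCount u n b j k : ℤ) = (n / u : ℕ) := fun j => by
    have := sum_residueCount_mul (u := u) (n := n) hb j (fun _ => (1 : ℤ))
    simpa [card_filter_modEq hu0 hun] using this
  have hfin := mul_le_sum_abs_of_intDvd (a := a) hp ht htp hζ
    (d := fun k => (residueCount u n b j k : ℤ) - residueCount u n b (j + 1) k)
    (by rw [Finset.sum_sub_distrib, hsum, hsum, sub_self])
    ⟨k, hk, sub_ne_zero.2 (by exact_mod_cast hjk)⟩ (by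
      convert hdiff using 3
      push_cast
      ring)
  have hle : ∑ k ∈ Finset.range p, |(residueCount u n b j k : ℤ) - residueCount u n b (j + 1) k|
      ≤ 2 * (n / u : ℕ) := by
    calc _ ≤ ∑ k ∈ Finset.range p,
          ((residueCount u n b j k : ℤ) + residueCount u n b (j + 1) k) :=
          Finset.sum_le_sum fun k _ => abs_le.2 ⟨by omega, by omega⟩
      _ = _ := by rw [Finset.sum_add_distrib, hsum, hsum, two_mul]
  exact_mod_cast hfin.trans hle

/-! ### The four assertions -/

/-- In the exponents, `r / 2` is division of natural numbers, i.e. `⌊r / 2⌋`, which is exact where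
`r` is even; likewise `(r + 1) / 2` is exact where `r` is odd. The bounds compare rationals. -/
theorem theorem2 (p : ℕ) (hp : p.Prime) (n : ℕ) (hn : 0 < n) (γ : ℤ)
    (hγ : |γ| < (n : ℤ)) (hpn : (p : ℤ) ∣ (n : ℤ) - γ)
    (hex : ∃ a : ℕ → ℂ, IsPAryNPS p n γ a) :
    -- (i)
    (γ = 0 → ∀ q r u : ℕ, q.Prime → q ≠ p → q ∣ n → ExactPowDvd q r (n : ℤ) →
      1 ≤ u → u ∣ n → IsSelfConjugateMod q (u * p) →
      Even r ∧ (q : ℚ) ^ (r / 2) ≤ (n : ℚ) / (u : ℚ)) ∧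
    -- (ii)
    (γ ≠ 0 → ∀ q r u : ℕ, q.Prime → q ≠ p → (q : ℤ) ∣ (n : ℤ) - γ →
      ExactPowDvd q r ((n : ℤ) - γ) → 1 < u → u ∣ n → IsSelfConjugateMod q (u * p) →
      (¬ q ∣ u → Even r ∧ (q : ℚ) ^ (r / 2) ≤ (n : ℚ) / (u : ℚ)) ∧
      (q ∣ u → (q : ℚ) ^ (r / 2) ≤ 2 * ((n : ℚ) / (u : ℚ)))) ∧
    -- (iii)
    (γ ≠ 0 → ∀ r u : ℕ, ExactPowDvd p r ((n : ℤ) - γ) →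
      1 < u → u ∣ n → ¬ p ∣ u → IsSelfConjugateMod p u →
      (Even r → (p : ℚ) ^ (r / 2) ≤ 2 * ((n : ℚ) / (u : ℚ))) ∧
      (Odd r → (p : ℚ) ^ ((r + 1) / 2) ≤ 4 * ((n : ℚ) / (u : ℚ)))) ∧
    -- (iv)
    (γ ≠ 0 → ∀ q r u : ℕ, q.Prime → q ≠ p → (q : ℤ) ∣ (γ + 1) * (n : ℤ) - γ →
      ExactPowDvd q r ((γ + 1) * (n : ℤ) - γ) → 1 ≤ u → u ∣ n →
      IsSelfConjugateMod q (u * p) → ¬ q ∣ u → Even r) := by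
  obtain ⟨a, ha⟩ := hex
  obtain ⟨b, hb, hbn, hcorr⟩ := ha.exists_exponents hp
  have hN : (n : ℤ) - γ ≠ 0 := by have := le_abs_self γ; omega
  have hne : ∀ u, u ∣ n → ∀ ζ ω, IsPrimitiveRoot ζ p → ω ^ u = 1 → ω ≠ 1 →
      charSum n b ζ ω * conj (charSum n b ζ ω) = ((n - γ : ℤ) : ℂ) := by
    rintro u ⟨c, hc⟩ ζ ω hζ hω hω1
    exact charSum_mul_conj_of_ne_one hn hbn (hζ.norm'_eq_one hp.ne_zero) (hcorr ζ hζ)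
      (by rw [hc, pow_mul, hω, one_pow]) hω1
  have hne0 : ∀ u, u ∣ n → ∀ ζ ω, IsPrimitiveRoot ζ p → ω ^ u = 1 → ω ≠ 1 →
      charSum n b ζ ω ≠ 0 := by
    intro u hun ζ ω hζ hω hω1 h0
    have := hne u hun ζ ω hζ hω hω1
    rw [h0, zero_mul] at this
    exact hN (by exact_mod_cast this.symm)
  have hζ := Complex.isPrimitiveRoot_exp p hp.ne_zero
  have heven : ∀ q r u, q.Prime → q ≠ p → IsSelfConjugateMod q (u * p) →
      ExactPowDvd q r ((γ + 1) * (n : ℤ) - γ) → Even r := by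
    intro q r u hq hqp hsc hr
    refine even_of_exactPowDvd_mul_conj hq hp.pos (hsc.exists_dvd_pow_add_one (dvd_mul_left p u)
      ((Nat.coprime_primes hq hp).2 hqp)) hζ (X := charSum n b _ 1) (sum_mem fun i _ => ?_)
      (charSum_one_mul_conj hn hbn (hζ.norm'_eq_one hp.ne_zero) (hcorr _ hζ)) hr
    rw [one_pow, mul_one]
    exact pow_mem (Algebra.self_mem_adjoin_singleton ℤ _) _
  have hmem : ∀ u, 0 < u → ∀ ζ ω : ℂ, IsPrimitiveRoot ζ p → ω ^ u = 1 → ∀ Ω,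
      IsPrimitiveRoot Ω (u * p) → charSum n b ζ ω ∈ Algebra.adjoin ℤ {Ω} := by
    intro u hu ζ ω hζ hω Ω hΩ
    have hup := Nat.mul_pos hu hp.pos
    refine sum_mem fun i _ => mul_mem (pow_mem (mem_adjoin_of_pow_eq_one hup hΩ ?_) _)
      (pow_mem (mem_adjoin_of_pow_eq_one hup hΩ ?_) _)
    · rw [mul_comm, pow_mul, hζ.pow_eq_one, one_pow]
    · rw [pow_mul, hω, one_pow]
  have hbound : ∀ q r u, q.Prime → q ≠ p → (q : ℤ) ^ r ∣ (n : ℤ) - γ → 1 < u → u ∣ n →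
      IsSelfConjugateMod q (u * p) → (q : ℚ) ^ (r / 2) ≤ (n : ℚ) / (u : ℚ) := by
    intro q r u hq hqp hr hu hun hsc
    have hup := Nat.mul_pos (zero_lt_one.trans hu) hp.pos
    have := pow_le_div_of_intDvd_charSum (a := r / 2) hp hq hqp hu hn hun hb
      (fun ζ ω hζ hω hω1 => intDvd_pow_of_mul_conj hq hup hsc
        (Complex.isPrimitiveRoot_exp _ hup.ne')
        (hmem u (zero_lt_one.trans hu) ζ ω hζ hω _ (Complex.isPrimitiveRoot_exp _ hup.ne'))
        (hne u hun ζ ω hζ hω hω1) hr) (hne0 u hun)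
    rw [← Nat.cast_div_charZero hun]
    exact_mod_cast this
  refine ⟨?_, ?_, ?_, ?_⟩
  · rintro rfl q r u hq hqp hqn hr hu hun hsc
    refine ⟨heven q r u hq hqp hsc (by simpa using hr), ?_⟩
    -- For `u = 1` there is no nontrivial character, but `q ^ r ≤ n` suffices.
    rcases hu.eq_or_lt with rfl | hu
    · have h1 : q ^ r ≤ n := Nat.le_of_dvd hn (by exact_mod_cast hr.1)
      have h2 := (Nat.pow_le_pow_right hq.pos (Nat.div_le_self r 2)).trans h1
      rw [Nat.cast_one, div_one]
      exact_mod_cast h2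
    · exact hbound q r u hq hqp (by simpa using hr.1) hu hun hsc
  · intro _ q r u hq hqp _ hr hu hun hsc
    -- This bound also covers `q ∣ u`, without the factor `2`.
    have h1 := hbound q r u hq hqp hr.1 hu hun hsc
    refine ⟨fun hqu => ⟨?_, h1⟩, fun _ => h1.trans ?_⟩
    · have hu0 := zero_lt_one.trans hu
      have hup := Nat.mul_pos hu0 hp.pos
      have hΩ := Complex.isPrimitiveRoot_exp _ hup.ne'
      have hω := Complex.isPrimitiveRoot_exp u hu0.ne'
      exact even_of_exactPowDvd_mul_conj hq hup (hsc.exists_dvd_pow_add_one dvd_rfl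
        (Nat.Coprime.mul_right ((Nat.Prime.coprime_iff_not_dvd hq).2 hqu)
          ((Nat.coprime_primes hq hp).2 hqp))) hΩ
        (hmem u hu0 _ _ hζ hω.pow_eq_one _ hΩ)
        (hne u hun _ _ hζ hω.pow_eq_one (hω.ne_one hu)) hr
    · have : (0 : ℚ) ≤ (n : ℚ) / u := by positivity
      linarith
  · intro _ r u hr hu hun hpu hsc
    have key : ∀ a t, 1 ≤ t → t < p → 2 * ((p - 1) * a + t) ≤ (p - 1) * r + 1 →
        p ^ a * (t + 1) ≤ 2 * (n / u) := fun a t ht htp hat =>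
      pow_mul_le_of_charSum_mul_conj hp hu hun hpu hsc hb hN hr.1 (hne u hun) ht htp hat
    have hp2 := hp.two_le
    have hnu : 1 ≤ n / u := Nat.div_pos (Nat.le_of_dvd hn hun) (zero_lt_one.trans hu)
    rw [← Nat.cast_div_charZero hun]
    constructor
    · rintro ⟨c, rfl⟩
      rw [show (c + c) / 2 = c by omega]
      rcases c with _ | c
      · have : p ^ 0 ≤ 2 * (n / u) := by rw [pow_zero]; omega
        exact_mod_cast this
      -- For `r = 2 * (c + 1)`, the choice `t = p - 1` gives `p ^ c * (t + 1) = p ^ (c + 1)`.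
      · have := key c (p - 1) (by omega) (by omega) (by
          rw [show 2 * ((p - 1) * c + (p - 1)) = (p - 1) * (c + 1 + (c + 1)) by ring]
          exact Nat.le_succ _)
        rw [Nat.sub_add_cancel hp.one_le, ← pow_succ] at this
        exact_mod_cast this
    · rintro ⟨c, rfl⟩
      rw [show (2 * c + 1 + 1) / 2 = c + 1 by omega]
      -- For `r = 2 * c + 1` and `a = c` the constraint is `2 * t ≤ p`; then `p ≤ 2 * (p / 2 + 1)`
      -- costs the second factor `2`.
      have h1 := key c (p / 2) (by omega) (by omega) (by
        have : (p - 1) * (2 * c + 1) = 2 * ((p - 1) * c) + (p - 1) := by ring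
        omega)
      have h2 : p ^ (c + 1) ≤ 4 * (n / u) := by
        calc p ^ (c + 1) = p ^ c * p := pow_succ _ _
          _ ≤ p ^ c * (2 * (p / 2 + 1)) := Nat.mul_le_mul_left _ (by omega)
          _ = 2 * (p ^ c * (p / 2 + 1)) := by ring
          _ ≤ 2 * (2 * (n / u)) := Nat.mul_le_mul_left _ h1
          _ = 4 * (n / u) := by ring
      exact_mod_cast h2
  · intro _ q r u hq hqp _ hr _ _ hsc _
    exact heven q r u hq hqp hsc hr
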